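/- Let $\mathcal{E}$ be an elementary topos (a cartesian closed category with finite limits and a subobject classifier $\mathrm{true}\colon 1\to\Omega$) which is Boolean, i.e. every subobject of every object has a complement. A *quotient* of $\mathcal{E}$ is a connected geometric morphism $f\colon\mathcal{E}\to\mathcal{F}$ to an elementary topos $\mathcal{F}$, i.e. one whose inverse image $f^*$ is fully faithful; two quotients $f\colon\mathcal{E}\to\mathcal{F}$ and $f'\colon\mathcal{E}\to\mathcal{F}'$ are identified when there is an equivalence $e\colon\mathcal{F}\simeq\mathcal{F}'$ with $e\circ f\cong f'$. Suppose that $\mathcal{E}$ has a *local state classifier*, i.e. a colimit $\{\xi_X\colon X\to\Xi\}_{X\in\mathcal{E}}$ of the inclusion into $\mathcal{E}$ of its wide subcategory of monomorphisms. Then $\Xi$ is an internal meet-semilattice with top element $\xi_1\colon 1\to\Xi$ and with meet the unique morphism $\wedge\colon\Xi\times\Xi\to\Xi$ such that $\wedge\circ(\xi_X\times\xi_Y)=\xi_{X\times Y}$ for all $X,Y$; and $\Omega$ is an internal meet-semilattice with top element $\mathrm{true}$ and with meet the characteristic morphism of $\langle\mathrm{true},\mathrm{true}\rangle$. An internal filter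 of an internal semilattice is a subobject containing the top element, closed under meets and upward closed. The following three concepts correspond bijectively: 1. quotients of $\mathcal{E}$ (up to identification); 2. internal filters of $\Xi$; 3. internal semilattice homomorphisms $\Xi\to\Omega$. The internal filter $F\rightarrowtail\Xi$ corresponding to a quotient $f\colon \mathcal{E}\to\mathcal{F}$ is characterized by the property that an object $X$ lies in the essential image of $f^*$ if and only if $\xi_X$ factors through $F$; the homomorphism corresponding to an internal filter $F$ is its characteristic morphism. (The codomain $\mathcal{F}$ may always be taken in the same universes as $\mathcal{E}$: every connected geometric morphism from $\mathcal{E}$ to a topos in arbitrary universes is identified with one of these.) If moreover $\mathcal{E}$ is locally small, then the collection of quotients of $\mathcal{E}$ is small. Every Grothendieck topos (a category equivalent to the category of sheaves of sets on a small site) is a locally small elementary topos with a local state classifier. Hence all of the above applies to every Boolean Grothendieck topos; in particular its quotients form a small set. -/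

import Mathlib

open CategoryTheory CategoryTheory.Limits

universe w v' u' v u

set_option linter.unusedSectionVars false

noncomputable section

namespace ToposQuotient

attribute [local simp] prod.lift_fst prod.lift_snd prod.lift_fst_assoc prod.lift_snd_assoc
  pullback.lift_fst pullback.lift_snd

/-! ### Elementary toposes -/

/-- An elementary topos: a category with finite limits and a subobject classifier which is
cartesian closed (every functor `X ⨯ -` has a right adjoint). -/
class IsElementaryTopos (E : Type u) [Category.{v} E] : Prop where
  hasFiniteLimits : HasFiniteLimits E
  hasSubobjectClassifier : HasSubobjectClassifier E
  isLeftAdjoint_prod : ∀ X : E, (prod.functor.obj X).IsLeftAdjoint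

attribute [instance] IsElementaryTopos.hasFiniteLimits
  IsElementaryTopos.hasSubobjectClassifier IsElementaryTopos.isLeftAdjoint_prod

/-- Every subobject has a complement: some `T` such that `S ⊓ T` is the least subobject and
`S ⊔ T` is the greatest one. For a topos this says that the topos is Boolean. The lattice
operations are spelled out through the order so that no existence of unions is presupposed. -/
class IsBoolean (E : Type u) [Category.{v} E] : Prop where
  exists_complement : ∀ (X : E) (S : Subobject X), ∃ T : Subobject X,
    (∀ R : Subobject X, R ≤ S → R ≤ T → IsBot R) ∧
    (∀ R : Subobject X, S ≤ R → T ≤ R → IsTop R)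

/-- A Grothendieck topos relative to the universe `w` of small sets: a category equivalent to the
category of sheaves of sets on a small site. -/
class IsGrothendieckTopos (E : Type u) [Category.{v} E] : Prop where
  exists_site : ∃ (C : Type w) (_ : SmallCategory C) (J : GrothendieckTopology C),
    Nonempty (E ≌ Sheaf J (Type w))

/-! ### Geometric morphisms and quotients -/

/-- A geometric morphism `E → F`. -/
structure GeometricMorphism (E : Type u) [Category.{v} E] (F : Type u') [Category.{v'} F] where
  /-- the direct image functor `f_*` -/
  directImage : E ⥤ F
  /-- the inverse image functor `f^*` -/
  inverseImage : F ⥤ E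
  /-- `f^*` is left adjoint to `f_*` -/
  adj : inverseImage ⊣ directImage
  /-- `f^*` preserves finite limits -/
  preservesFiniteLimits : PreservesFiniteLimits inverseImage

namespace GeometricMorphism

variable {E : Type u} [Category.{v} E]

/-- A geometric morphism is connected if its inverse image is fully faithful. -/
structure IsConnected {F : Type u'} [Category.{v'} F] (f : GeometricMorphism E F) : Prop where
  full : f.inverseImage.Full
  faithful : f.inverseImage.Faithful

/-- The standard identification of geometric morphisms `f : E → F` and `g : E → G` out of `E`:
there is an equivalence `e : F ≌ G` such that `e ∘ f` is isomorphic to `g`. -/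
def Identified {F : Type*} [Category* F] {G : Type*} [Category* G]
    (f : GeometricMorphism E F) (g : GeometricMorphism E G) : Prop :=
  ∃ e : F ≌ G, Nonempty (f.directImage ⋙ e.functor ≅ g.directImage)

theorem Identified.refl {F : Type*} [Category* F] (f : GeometricMorphism E F) :
    f.Identified f :=
  ⟨CategoryTheory.Equivalence.refl, ⟨Functor.rightUnitor _⟩⟩

theorem Identified.symm {F : Type*} [Category* F] {G : Type*} [Category* G]
    {f : GeometricMorphism E F} {g : GeometricMorphism E G} (h : f.Identified g) :
    g.Identified f := by
  obtain ⟨e, ⟨i⟩⟩ := h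
  exact ⟨e.symm, ⟨Functor.isoWhiskerRight i.symm e.inverse ≪≫ Functor.associator _ _ _ ≪≫
    Functor.isoWhiskerLeft _ e.unitIso.symm ≪≫ Functor.rightUnitor _⟩⟩

theorem Identified.trans {F : Type*} [Category* F] {G : Type*} [Category* G]
    {H : Type*} [Category* H] {f : GeometricMorphism E F} {g : GeometricMorphism E G}
    {h : GeometricMorphism E H} (h₁ : f.Identified g) (h₂ : g.Identified h) :
    f.Identified h := by
  obtain ⟨e, ⟨i⟩⟩ := h₁
  obtain ⟨e', ⟨i'⟩⟩ := h₂
  exact ⟨e.trans e', ⟨(Functor.associator _ _ _).symm ≪≫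
    Functor.isoWhiskerRight i e'.functor ≪≫ i'⟩⟩

end GeometricMorphism

/-- A connected geometric morphism from `E` to some topos. -/
structure ConnectedMorphismFrom (E : Type u) [Category.{v} E] where
  /-- the codomain topos -/
  codomain : Type u
  /-- its category structure -/
  [category : Category.{v} codomain]
  /-- it is a topos -/
  [isElementaryTopos : IsElementaryTopos codomain]
  /-- the geometric morphism -/
  morphism : GeometricMorphism E codomain
  /-- it is connected -/
  isConnected : morphism.IsConnected

attribute [instance] ConnectedMorphismFrom.category ConnectedMorphismFrom.isElementaryTopos

/-- The standard identification on connected geometric morphisms out of `E`. -/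
instance identification (E : Type u) [Category.{v} E] : Setoid (ConnectedMorphismFrom E) where
  r p q := p.morphism.Identified q.morphism
  iseqv := ⟨fun _ => .refl _, fun h => h.symm, fun h h' => h.trans h'⟩

/-- The quotients of `E`: connected geometric morphisms out of `E`, up to the standard
identification. -/
def QuotientOf (E : Type u) [Category.{v} E] : Type (max (u + 1) (v + 1)) :=
  Quotient (identification E)

/-- The quotient of `E` given by a connected geometric morphism. -/
def ConnectedMorphismFrom.toQuotient {E : Type u} [Category.{v} E]
    (p : ConnectedMorphismFrom E) : QuotientOf E :=
  Quotient.mk (identification E) p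

/-! ### Internal semilattices and their filters -/

section Semilattice

variable {E : Type u} [Category.{v} E] [HasFiniteLimits E]

/-- An internal (bounded meet-)semilattice structure on the object `X`. -/
structure InternalSemilattice (X : E) where
  /-- the top element -/
  top : ⊤_ E ⟶ X
  /-- the binary meet -/
  meet : X ⨯ X ⟶ X
  top_meet : prod.lift (terminal.from X ≫ top) (𝟙 X) ≫ meet = 𝟙 X
  meet_top : prod.lift (𝟙 X) (terminal.from X ≫ top) ≫ meet = 𝟙 X
  meet_assoc : prod.map meet (𝟙 X) ≫ meet =
    (prod.associator X X X).hom ≫ prod.map (𝟙 X) meet ≫ meet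
  meet_comm : (prod.braiding X X).hom ≫ meet = meet
  meet_self : diag X ≫ meet = 𝟙 X

/-- Homomorphisms of internal semilattices. -/
@[ext]
structure SemilatticeHom {X Y : E} (L : InternalSemilattice X) (M : InternalSemilattice Y) where
  /-- the underlying morphism -/
  hom : X ⟶ Y
  map_top : L.top ≫ hom = M.top
  map_meet : L.meet ≫ hom = prod.map hom hom ≫ M.meet

/-- An internal filter of an internal semilattice: a subobject `F` which contains `⊤`, is closed
under `∧`, and is upward closed, i.e. for generalized elements `u ∈ F`, `x ∈ X` with `u ∧ x = u`
one has `x ∈ F`. -/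
structure IsInternalFilter {X : E} (L : InternalSemilattice X) (F : Subobject X) : Prop where
  top_mem : ∃ t : ⊤_ E ⟶ (F : E), t ≫ F.arrow = L.top
  meet_mem : ∃ m : (F : E) ⨯ (F : E) ⟶ (F : E),
    m ≫ F.arrow = prod.map F.arrow F.arrow ≫ L.meet
  upward_closed : ∃ l : equalizer (prod.map F.arrow (𝟙 X) ≫ L.meet) (prod.fst ≫ F.arrow) ⟶
      (F : E) ⨯ (F : E),
    l ≫ prod.map (𝟙 (F : E)) F.arrow =
      equalizer.ι (prod.map F.arrow (𝟙 X) ≫ L.meet) (prod.fst ≫ F.arrow)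

/-- The internal filters of an internal semilattice. -/
def InternalFilter {X : E} (L : InternalSemilattice X) : Type (max u v) :=
  {F : Subobject X // IsInternalFilter L F}

end Semilattice

/-! ### The semilattice structure of the subobject classifier -/

section Omega

variable {E : Type u} [Category.{v} E] [HasFiniteLimits E] (𝒞 : Subobject.Classifier E)

/-- The constant map `true : A ⟶ Ω`. -/
def trueAt (A : E) : A ⟶ 𝒞.Ω := 𝒞.χ₀ A ≫ 𝒞.truth

theorem comp_trueAt {A B : E} (f : A ⟶ B) : f ≫ trueAt 𝒞 B = trueAt 𝒞 A := by
  unfold trueAt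
  rw [← Category.assoc]
  congr 1
  exact Subsingleton.elim _ _

/-- Maps into `Ω` are determined by the generalized elements that they send to `true`. -/
theorem omega_ext {A : E} {a b : A ⟶ 𝒞.Ω}
    (h : ∀ (B : E) (t : B ⟶ A), t ≫ a = trueAt 𝒞 B ↔ t ≫ b = trueAt 𝒞 B) : a = b := by
  have key : ∀ c : A ⟶ 𝒞.Ω,
      (∀ (B : E) (t : B ⟶ A), t ≫ a = trueAt 𝒞 B ↔ t ≫ c = trueAt 𝒞 B) →
      c = 𝒞.χ (pullback.fst a 𝒞.truth) := by
    intro c hc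
    have ht : pullback.fst a 𝒞.truth ≫ a = trueAt 𝒞 _ := by
      rw [pullback.condition, trueAt]
      congr 1
      exact Subsingleton.elim _ _
    refine 𝒞.uniq (χ₀' := 𝒞.χ₀ _) _ ⟨⟨(hc _ _).1 ht⟩, ⟨PullbackCone.IsLimit.mk _
      (fun s => pullback.lift s.fst s.snd ?_) ?_ ?_ ?_⟩⟩
    · have h1 : s.fst ≫ c = trueAt 𝒞 _ := by
        rw [s.condition, trueAt]
        congr 1
        exact Subsingleton.elim _ _
      rw [(hc _ _).2 h1, trueAt]
      congr 1
      exact Subsingleton.elim _ _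
    · intro s
      simp
    · intro s
      exact Subsingleton.elim _ _
    · intro s m h1 _
      rw [← cancel_mono (pullback.fst a 𝒞.truth), h1]
      simp
  rw [key a (fun _ _ => Iff.rfl), key b h]

instance mono_of_terminal {X : E} (f : ⊤_ E ⟶ X) : Mono f :=
  IsTerminal.mono_from terminalIsTerminal f

/-- The meet of `Ω`: the characteristic map of `⟨true, true⟩ : 1 ⟶ Ω ⨯ Ω`. -/
def omegaMeet : 𝒞.Ω ⨯ 𝒞.Ω ⟶ 𝒞.Ω :=
  𝒞.χ (prod.lift (trueAt 𝒞 (⊤_ E)) (trueAt 𝒞 (⊤_ E)))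

theorem comp_omegaMeet {A : E} (a : A ⟶ 𝒞.Ω ⨯ 𝒞.Ω) :
    a ≫ omegaMeet 𝒞 = trueAt 𝒞 A ↔
      a ≫ prod.fst = trueAt 𝒞 A ∧ a ≫ prod.snd = trueAt 𝒞 A := by
  have hp := 𝒞.isPullback (prod.lift (trueAt 𝒞 (⊤_ E)) (trueAt 𝒞 (⊤_ E)))
  constructor
  · intro h
    have e : hp.lift a (𝒞.χ₀ A) h ≫ _ = a := hp.lift_fst a (𝒞.χ₀ A) h
    rw [← e]
    simp [comp_trueAt]
  · rintro ⟨h1, h2⟩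
    have e : a = terminal.from A ≫ prod.lift (trueAt 𝒞 (⊤_ E)) (trueAt 𝒞 (⊤_ E)) := by
      apply Limits.prod.hom_ext
      · simp [h1, comp_trueAt]
      · simp [h2, comp_trueAt]
    rw [e, Category.assoc]
    have hw : _ ≫ omegaMeet 𝒞 = _ := hp.w
    rw [hw, ← trueAt, comp_trueAt]

/-- The canonical internal semilattice structure of the subobject classifier. -/
def omegaSemilattice : InternalSemilattice 𝒞.Ω where
  top := trueAt 𝒞 (⊤_ E)
  meet := omegaMeet 𝒞
  top_meet := by
    apply omega_ext
    intro B t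
    rw [← Category.assoc, comp_omegaMeet]
    simp [comp_trueAt]
  meet_top := by
    apply omega_ext
    intro B t
    rw [← Category.assoc, comp_omegaMeet]
    simp [comp_trueAt]
  meet_assoc := by
    apply omega_ext
    intro B t
    rw [← Category.assoc, comp_omegaMeet, ← Category.assoc, ← Category.assoc, comp_omegaMeet]
    simp only [Category.assoc, prod.map_fst, prod.map_snd]
    rw [← Category.assoc t, comp_omegaMeet]
    have : t ≫ (prod.associator 𝒞.Ω 𝒞.Ω 𝒞.Ω).hom ≫ prod.snd ≫ omegaMeet 𝒞 =
      (t ≫ (prod.associator 𝒞.Ω 𝒞.Ω 𝒞.Ω).hom ≫ prod.snd) ≫ omegaMeet 𝒞 := by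
      simp only [Category.assoc]
    rw [this, comp_omegaMeet]
    simp [and_assoc]
  meet_comm := by
    apply omega_ext
    intro B t
    rw [← Category.assoc, comp_omegaMeet, comp_omegaMeet]
    simp [and_comm]
  meet_self := by
    apply omega_ext
    intro B t
    rw [← Category.assoc, comp_omegaMeet]
    simp

end Omega

/-! ### Local state classifiers -/

/-- A local state classifier: a colimit of the inclusion of the wide subcategory of monomorphisms
into the category. -/
abbrev LocalStateClassifier (E : Type u) [Category.{v} E] :=
  ColimitCocone (wideSubcategoryInclusion (MorphismProperty.monomorphisms E))

namespace LocalStateClassifier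

variable {E : Type u} [Category.{v} E] (𝒮 : LocalStateClassifier E)

/-- The underlying object `Ξ`. -/
def Ξ : E := 𝒮.cocone.pt

/-- The component `ξ_X : X ⟶ Ξ` of the colimit cocone. -/
def ξ (X : E) : X ⟶ 𝒮.Ξ := 𝒮.cocone.ι.app ⟨X⟩

/-- The cocone is locally determined. -/
theorem mono_comp_ξ {X Y : E} (i : X ⟶ Y) [Mono i] : i ≫ 𝒮.ξ Y = 𝒮.ξ X :=
  𝒮.cocone.w
    (show (⟨X⟩ : WideSubcategory (MorphismProperty.monomorphisms E)) ⟶ ⟨Y⟩ from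
      ⟨i, MorphismProperty.monomorphisms.infer_property i⟩)

theorem hom_ext {Z : E} {f g : 𝒮.Ξ ⟶ Z} (h : ∀ X, 𝒮.ξ X ≫ f = 𝒮.ξ X ≫ g) : f = g :=
  𝒮.isColimit.hom_ext fun X => h X.obj

variable [IsElementaryTopos E]

/-- Since `A ⨯ -` is a left adjoint, `A ⨯ Ξ` is the colimit of the objects `A ⨯ X`. -/
def prodIsColimit (A : E) : IsColimit ((prod.functor.obj A).mapCocone 𝒮.cocone) :=
  haveI := (Adjunction.ofIsLeftAdjoint (prod.functor.obj A)).leftAdjoint_preservesColimits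
  isColimitOfPreserves (prod.functor.obj A) 𝒮.isColimit

theorem prod_hom_ext {A Z : E} {f g : A ⨯ 𝒮.Ξ ⟶ Z}
    (h : ∀ X, prod.map (𝟙 A) (𝒮.ξ X) ≫ f = prod.map (𝟙 A) (𝒮.ξ X) ≫ g) : f = g :=
  (𝒮.prodIsColimit A).hom_ext fun X => h X.obj

theorem prod_hom_ext' {A Z : E} {f g : 𝒮.Ξ ⨯ A ⟶ Z}
    (h : ∀ X, prod.map (𝒮.ξ X) (𝟙 A) ≫ f = prod.map (𝒮.ξ X) (𝟙 A) ≫ g) : f = g := by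
  rw [← cancel_epi (prod.braiding A 𝒮.Ξ).hom]
  apply 𝒮.prod_hom_ext
  intro X
  rw [← Category.assoc, ← Category.assoc, braid_natural, Category.assoc, Category.assoc, h]

/-- A family of maps `A ⨯ X ⟶ Z` compatible with monomorphisms in `X` glues to `A ⨯ Ξ ⟶ Z`. -/
def prodDesc {A Z : E} (k : ∀ X : E, A ⨯ X ⟶ Z)
    (hk : ∀ (X Y : E) (i : X ⟶ Y) [Mono i], prod.map (𝟙 A) i ≫ k Y = k X) : A ⨯ 𝒮.Ξ ⟶ Z :=
  (𝒮.prodIsColimit A).desc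
    { pt := Z
      ι :=
        { app := fun X => k X.obj
          naturality := fun X Y i => by
            have : Mono i.hom := i.property
            refine (hk X.obj Y.obj i.hom).trans ?_
            exact (Category.comp_id _).symm } }

theorem map_prodDesc {A Z : E} (k : ∀ X : E, A ⨯ X ⟶ Z)
    (hk : ∀ (X Y : E) (i : X ⟶ Y) [Mono i], prod.map (𝟙 A) i ≫ k Y = k X) (X : E) :
    prod.map (𝟙 A) (𝒮.ξ X) ≫ 𝒮.prodDesc k hk = k X :=
  (𝒮.prodIsColimit A).fac _ ⟨X⟩

/-- The map `A ⨯ Ξ ⟶ Ξ` with components `ξ_{A ⨯ X}`. -/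
def meetAux (A : E) : A ⨯ 𝒮.Ξ ⟶ 𝒮.Ξ :=
  𝒮.prodDesc (fun X => 𝒮.ξ (A ⨯ X)) fun _ _ _ _ => 𝒮.mono_comp_ξ _

theorem map_meetAux (A X : E) : prod.map (𝟙 A) (𝒮.ξ X) ≫ 𝒮.meetAux A = 𝒮.ξ (A ⨯ X) :=
  𝒮.map_prodDesc _ _ X

theorem mono_meetAux {A B : E} (i : A ⟶ B) [Mono i] :
    prod.map i (𝟙 𝒮.Ξ) ≫ 𝒮.meetAux B = 𝒮.meetAux A := by
  apply 𝒮.prod_hom_ext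
  intro X
  have e : prod.map (𝟙 A) (𝒮.ξ X) ≫ prod.map i (𝟙 𝒮.Ξ) =
      prod.map i (𝟙 X) ≫ prod.map (𝟙 B) (𝒮.ξ X) := by simp
  rw [← Category.assoc, e, Category.assoc, map_meetAux, map_meetAux, 𝒮.mono_comp_ξ]

/-- The meet `Ξ ⨯ Ξ ⟶ Ξ`, see `map_meet` for its characterization. -/
def meet : 𝒮.Ξ ⨯ 𝒮.Ξ ⟶ 𝒮.Ξ :=
  (prod.braiding _ _).hom ≫
    𝒮.prodDesc (fun X => (prod.braiding _ _).hom ≫ 𝒮.meetAux X) (fun X Y i _ => by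
      rw [← Category.assoc, braid_natural, Category.assoc, mono_meetAux])

/-- The meet is the unique map with `(ξ_X × ξ_Y) ≫ meet = ξ_{X × Y}`. -/
theorem map_meet (X Y : E) : prod.map (𝒮.ξ X) (𝒮.ξ Y) ≫ 𝒮.meet = 𝒮.ξ (X ⨯ Y) := by
  have e : prod.map (𝒮.ξ X) (𝒮.ξ Y) = prod.map (𝟙 X) (𝒮.ξ Y) ≫ prod.map (𝒮.ξ X) (𝟙 _) := by
    simp
  rw [e, meet, Category.assoc, ← Category.assoc (prod.map (𝒮.ξ X) (𝟙 _)), braid_natural,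
    Category.assoc, map_prodDesc, ← Category.assoc (prod.braiding _ _).hom, prod.symmetry,
    Category.id_comp, map_meetAux]

theorem prod_prod_hom_ext {Z : E} {f g : 𝒮.Ξ ⨯ 𝒮.Ξ ⟶ Z}
    (h : ∀ X Y, prod.map (𝒮.ξ X) (𝒮.ξ Y) ≫ f = prod.map (𝒮.ξ X) (𝒮.ξ Y) ≫ g) : f = g := by
  apply 𝒮.prod_hom_ext'
  intro X
  apply 𝒮.prod_hom_ext
  intro Y
  simpa using h X Y

/-- The canonical internal semilattice structure of a local state classifier: the top element is
`ξ_1` and the meet is the unique map with `(ξ_X × ξ_Y) ≫ meet = ξ_{X × Y}`. -/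
def semilattice : InternalSemilattice 𝒮.Ξ where
  top := 𝒮.ξ (⊤_ E)
  meet := 𝒮.meet
  top_meet := by
    apply 𝒮.hom_ext
    intro X
    have e : 𝒮.ξ X ≫ prod.lift (terminal.from 𝒮.Ξ ≫ 𝒮.ξ (⊤_ E)) (𝟙 𝒮.Ξ) =
        prod.lift (terminal.from X) (𝟙 X) ≫ prod.map (𝒮.ξ (⊤_ E)) (𝒮.ξ X) := by
      apply Limits.prod.hom_ext <;> simp
    have : Mono (prod.lift (terminal.from X) (𝟙 X)) :=
      mono_of_mono_fac (h := 𝟙 X) (prod.lift_snd _ _)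
    rw [← Category.assoc, e, Category.assoc, map_meet, 𝒮.mono_comp_ξ, Category.comp_id]
  meet_top := by
    apply 𝒮.hom_ext
    intro X
    have e : 𝒮.ξ X ≫ prod.lift (𝟙 𝒮.Ξ) (terminal.from 𝒮.Ξ ≫ 𝒮.ξ (⊤_ E)) =
        prod.lift (𝟙 X) (terminal.from X) ≫ prod.map (𝒮.ξ X) (𝒮.ξ (⊤_ E)) := by
      apply Limits.prod.hom_ext <;> simp
    have : Mono (prod.lift (𝟙 X) (terminal.from X)) :=
      mono_of_mono_fac (h := 𝟙 X) (prod.lift_fst _ _)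
    rw [← Category.assoc, e, Category.assoc, map_meet, 𝒮.mono_comp_ξ, Category.comp_id]
  meet_assoc := by
    apply 𝒮.prod_hom_ext
    intro Z
    have swap : ∀ {k : (𝒮.Ξ ⨯ 𝒮.Ξ) ⨯ Z ⟶ 𝒮.Ξ} {l : (𝒮.Ξ ⨯ 𝒮.Ξ) ⨯ Z ⟶ 𝒮.Ξ},
        (∀ X Y, prod.map (prod.map (𝒮.ξ X) (𝒮.ξ Y)) (𝟙 Z) ≫ k =
          prod.map (prod.map (𝒮.ξ X) (𝒮.ξ Y)) (𝟙 Z) ≫ l) → k = l := by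
      intro k l h
      rw [← cancel_epi (prod.associator 𝒮.Ξ 𝒮.Ξ Z).inv]
      apply 𝒮.prod_hom_ext'
      intro X
      rw [← cancel_epi (prod.associator X 𝒮.Ξ Z).hom,
        ← cancel_epi (prod.map (prod.braiding 𝒮.Ξ X).hom (𝟙 Z)),
        ← cancel_epi (prod.associator 𝒮.Ξ X Z).inv]
      apply 𝒮.prod_hom_ext'
      intro Y
      have e : prod.map (𝒮.ξ Y) (𝟙 (X ⨯ Z)) ≫ (prod.associator 𝒮.Ξ X Z).inv ≫
          prod.map (prod.braiding 𝒮.Ξ X).hom (𝟙 Z) ≫ (prod.associator X 𝒮.Ξ Z).hom ≫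
          prod.map (𝒮.ξ X) (𝟙 (𝒮.Ξ ⨯ Z)) ≫ (prod.associator 𝒮.Ξ 𝒮.Ξ Z).inv =
          prod.lift (prod.lift (prod.snd ≫ prod.fst) prod.fst) (prod.snd ≫ prod.snd) ≫
            prod.map (prod.map (𝒮.ξ X) (𝒮.ξ Y)) (𝟙 Z) := by
        apply Limits.prod.hom_ext
        · apply Limits.prod.hom_ext <;> simp
        · simp
      have e' := fun m : (𝒮.Ξ ⨯ 𝒮.Ξ) ⨯ Z ⟶ 𝒮.Ξ => congrArg (fun t => t ≫ m) e
      simp only [Category.assoc] at e'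
      rw [e', e', h]
    apply swap
    intro X Y
    have e1 : prod.map (prod.map (𝒮.ξ X) (𝒮.ξ Y)) (𝟙 Z) ≫ prod.map (𝟙 (𝒮.Ξ ⨯ 𝒮.Ξ)) (𝒮.ξ Z) ≫
        prod.map 𝒮.meet (𝟙 𝒮.Ξ) = prod.map (𝒮.ξ (X ⨯ Y)) (𝒮.ξ Z) := by
      simp [map_meet]
    have e2 : prod.map (prod.map (𝒮.ξ X) (𝒮.ξ Y)) (𝟙 Z) ≫ prod.map (𝟙 (𝒮.Ξ ⨯ 𝒮.Ξ)) (𝒮.ξ Z) ≫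
        (prod.associator 𝒮.Ξ 𝒮.Ξ 𝒮.Ξ).hom ≫ prod.map (𝟙 𝒮.Ξ) 𝒮.meet =
        (prod.associator X Y Z).hom ≫ prod.map (𝒮.ξ X) (𝒮.ξ (Y ⨯ Z)) := by
      rw [← map_meet]
      apply Limits.prod.hom_ext
      · simp
      · have e3 : prod.map (prod.map (𝒮.ξ X) (𝒮.ξ Y)) (𝟙 Z) ≫
            prod.map (𝟙 (𝒮.Ξ ⨯ 𝒮.Ξ)) (𝒮.ξ Z) ≫
            (prod.associator 𝒮.Ξ 𝒮.Ξ 𝒮.Ξ).hom ≫ prod.snd =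
            (prod.associator X Y Z).hom ≫ prod.snd ≫ prod.map (𝒮.ξ Y) (𝒮.ξ Z) := by
          apply Limits.prod.hom_ext <;> simp
        have e4 := congrArg (fun t => t ≫ 𝒮.meet) e3
        simp only [Category.assoc] at e4
        simpa only [Category.assoc, prod.map_snd] using e4
    have e1' := congrArg (fun t => t ≫ 𝒮.meet) e1
    have e2' := congrArg (fun t => t ≫ 𝒮.meet) e2
    simp only [Category.assoc] at e1' e2'
    rw [e1', e2', map_meet, map_meet, 𝒮.mono_comp_ξ]
  meet_comm := by
    apply 𝒮.prod_prod_hom_ext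
    intro X Y
    rw [← Category.assoc, braid_natural, Category.assoc, map_meet, map_meet, 𝒮.mono_comp_ξ]
  meet_self := by
    apply 𝒮.hom_ext
    intro X
    have e : 𝒮.ξ X ≫ diag 𝒮.Ξ = diag X ≫ prod.map (𝒮.ξ X) (𝒮.ξ X) := by simp
    rw [← Category.assoc, e, Category.assoc, map_meet, 𝒮.mono_comp_ξ, Category.comp_id]

end LocalStateClassifier

end ToposQuotient

end

open ToposQuotient

/-! Let `f` be a connected geometric morphism out of the Boolean topos `E`. The crucial point is
that the essential image of `f^*` is closed under subobjects. Since `true` and `false` are jointly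
epimorphic on `Ω`, the object `Ω` embeds into `f^*Ω_F` as the pair of disjoint points `f^*true`,
`f^*false`. A characteristic map on `f^*X` therefore becomes a map `f^*X ⟶ f^*Ω_F`; by fullness it
comes from `F`, and so does the subobject (`essImage_of_mono`). Applied to the kernel pair of the
counit, this shows that the counit is monic (`mono_counit`), so `f^*f_*X` is the largest subobject
of `X` in the image. The characteristic maps `X ⟶ Ω` of these subobjects are compatible with
monomorphisms, hence glue to a map `Ξ ⟶ Ω`. It respects tops and meets because `f^*` preserves
finite products, so it classifies an internal filter. Conversely, let `G` be a filter and consider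
the objects `X` with `ξ_X` in `G`. For every `g : Z ⟶ X` the graph `Z ⟶ Z × X` is monic, so `ξ_Z ∧
(ξ_X ∘ g) = ξ_Z`; upward closure then makes `g` factor through the pullback of `G` along `ξ_X`. The
subcategory is thus coreflective, with monic counit, and closed under subobjects and finite
products; this makes it a topos. Both a quotient and a filter are determined by the resulting class
of objects, which gives the bijection. Smallness follows since quotients embed into `Hom(Ξ, Ω)`. In
a sheaf topos, the subsheaf generated by a section is determined up to isomorphism by which pairs of
restrictions of the section agree. These relations form a small presheaf, whose sheafification is
`Ξ`. -/

noncomputable section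

namespace ToposQuotient

attribute [local simp] prod.lift_fst prod.lift_snd prod.lift_fst_assoc prod.lift_snd_assoc
  pullback.lift_fst pullback.lift_snd

/-! ### The initial object of an elementary topos -/

section Initial

variable {E : Type u} [Category.{v} E] [IsElementaryTopos E]

/-- Currying: maps `A ⨯ B ⟶ Z` are maps from `B` to the exponential. -/
def expEquiv (A B Z : E) : (A ⨯ B ⟶ Z) ≃ (B ⟶ (prod.functor.obj A).rightAdjoint.obj Z) :=
  (Adjunction.ofIsLeftAdjoint (prod.functor.obj A)).homEquiv B Z

theorem expEquiv_comp {A B B' Z : E} (g : B' ⟶ B) (f : A ⨯ B ⟶ Z) :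
    g ≫ expEquiv A B Z f = expEquiv A B' Z (prod.map (𝟙 A) g ≫ f) :=
  ((Adjunction.ofIsLeftAdjoint (prod.functor.obj A)).homEquiv_naturality_left g f).symm

variable (𝒞 : Subobject.Classifier E)

theorem comp_χ_self {U X : E} (m : U ⟶ X) [Mono m] : m ≫ 𝒞.χ m = trueAt 𝒞 U :=
  (𝒞.isPullback m).w

theorem comp_χ_iff {U X B : E} (m : U ⟶ X) [Mono m] (t : B ⟶ X) :
    t ≫ 𝒞.χ m = trueAt 𝒞 B ↔ ∃ l : B ⟶ U, l ≫ m = t := by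
  constructor
  · intro h
    exact ⟨(𝒞.isPullback m).lift t (𝒞.χ₀ B) h, (𝒞.isPullback m).lift_fst _ _ _⟩
  · rintro ⟨l, rfl⟩
    rw [Category.assoc, comp_χ_self, comp_trueAt]

/-- An object all of whose generalized truth values are `true`. -/
def IsNull (B : E) : Prop :=
  ∀ (A : E) (_ : A ⟶ B) (c : A ⟶ 𝒞.Ω), c = trueAt 𝒞 A

variable {𝒞}

theorem IsNull.of_hom {A B : E} (h : IsNull 𝒞 B) (f : A ⟶ B) : IsNull 𝒞 A :=
  fun A' t c => h A' (t ≫ f) c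

/-- The characteristic map of `m` is forced to be `true`. -/
theorem IsNull.exists_section {U B : E} (h : IsNull 𝒞 B) (m : U ⟶ B) [Mono m] :
    ∃ l : B ⟶ U, l ≫ m = 𝟙 B :=
  (comp_χ_iff 𝒞 m (𝟙 B)).1 (by rw [Category.id_comp]; exact h B (𝟙 B) _)

theorem IsNull.hom_eq {B Y : E} (h : IsNull 𝒞 B) (a b : B ⟶ Y) : a = b := by
  obtain ⟨l, hl⟩ := h.exists_section (equalizer.ι a b)
  rw [← Category.id_comp a, ← Category.id_comp b, ← hl, Category.assoc, Category.assoc,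
    equalizer.condition]

variable (𝒞) in
/-- The map `Y ⟶ Ω ^ Y` sending `y` to `{y}`. -/
def singletonMap (Y : E) : Y ⟶ (prod.functor.obj Y).rightAdjoint.obj 𝒞.Ω :=
  expEquiv Y Y 𝒞.Ω (𝒞.χ (diag Y))

/-- If `{a} = {b}`, then testing membership of `a` on both sides gives `a = b`. -/
instance mono_singletonMap (Y : E) : Mono (singletonMap 𝒞 Y) := by
  constructor
  intro A a b h
  rw [singletonMap, expEquiv_comp, expEquiv_comp] at h
  have h1 := congrArg (fun t => prod.lift a (𝟙 A) ≫ t) ((expEquiv Y A 𝒞.Ω).injective h)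
  simp only [← Category.assoc, prod.lift_map, Category.comp_id, Category.id_comp] at h1
  have h2 : prod.lift a a ≫ 𝒞.χ (diag Y) = trueAt 𝒞 A :=
    (comp_χ_iff 𝒞 _ _).2 ⟨a, by simp⟩
  rw [h2] at h1
  obtain ⟨l, hl⟩ := (comp_χ_iff 𝒞 _ _).1 h1.symm
  have ha := congrArg (fun t => t ≫ prod.fst) hl
  have hb := congrArg (fun t => t ≫ prod.snd) hl
  simp at ha hb
  rw [← ha, hb]

/-- Pull back the singleton embedding along the name of the full subobject of `Y`. Over a null
object this monomorphism splits, and its other projection lands in `Y`. -/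
theorem IsNull.nonempty_hom {B : E} (h : IsNull 𝒞 B) (Y : E) : Nonempty (B ⟶ Y) := by
  let p : B ⟶ (prod.functor.obj Y).rightAdjoint.obj 𝒞.Ω := expEquiv Y B 𝒞.Ω (trueAt 𝒞 _)
  obtain ⟨l, -⟩ := h.exists_section (pullback.fst p (singletonMap 𝒞 Y))
  exact ⟨l ≫ pullback.snd _ _⟩

theorem IsNull.nonempty_isInitial {B : E} (h : IsNull 𝒞 B) : Nonempty (IsInitial B) :=
  ⟨IsInitial.ofUniqueHom (fun Y => (h.nonempty_hom Y).some) fun _ _ => h.hom_eq _ _⟩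

variable (𝒞)

/-- The equalizer is the extent of the truth value `∀ c : Ω, c`, the impredicative encoding of
falsity; this provides an initial object without assuming colimits. -/
theorem exists_isNull : ∃ B : E, IsNull 𝒞 B := by
  let a : ⊤_ E ⟶ (prod.functor.obj 𝒞.Ω).rightAdjoint.obj 𝒞.Ω := expEquiv _ _ _ prod.fst
  let b : ⊤_ E ⟶ (prod.functor.obj 𝒞.Ω).rightAdjoint.obj 𝒞.Ω :=
    expEquiv _ _ _ (trueAt 𝒞 _)
  refine ⟨equalizer a b, fun A t c => ?_⟩
  have h : (t ≫ equalizer.ι a b) ≫ a = (t ≫ equalizer.ι a b) ≫ b := by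
    rw [Category.assoc, Category.assoc, equalizer.condition]
  simp only [a, b, expEquiv_comp] at h
  have h1 := congrArg (fun t => prod.lift c (𝟙 A) ≫ t) ((expEquiv _ A 𝒞.Ω).injective h)
  simp only [prod.map_fst, comp_trueAt] at h1
  simpa using h1

theorem isNull_of_isInitial {B : E} (h : IsInitial B) : IsNull 𝒞 B := by
  obtain ⟨Z, hZ⟩ := exists_isNull 𝒞
  exact hZ.of_hom (h.to Z)

/-- A chosen null object. -/
def nullObj : E := (exists_isNull 𝒞).choose

theorem isNull_nullObj : IsNull 𝒞 (nullObj 𝒞) := (exists_isNull 𝒞).choose_spec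

variable {𝒞} in
theorem IsNull.mono {B X : E} (h : IsNull 𝒞 B) (m : B ⟶ X) : Mono m :=
  ⟨fun a b _ => (h.of_hom a).hom_eq a b⟩

instance mono_from_nullObj {X : E} (m : nullObj 𝒞 ⟶ X) : Mono m := (isNull_nullObj 𝒞).mono m

/-- The constant map `false : A ⟶ Ω`. -/
def falseAt (A : E) : A ⟶ 𝒞.Ω := terminal.from A ≫ 𝒞.χ (terminal.from (nullObj 𝒞))

theorem comp_falseAt {A B : E} (f : A ⟶ B) : f ≫ falseAt 𝒞 B = falseAt 𝒞 A := by
  rw [falseAt, falseAt, ← Category.assoc, Subsingleton.elim (f ≫ terminal.from B)]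

theorem falseAt_eq_trueAt {A : E} : falseAt 𝒞 A = trueAt 𝒞 A ↔ IsNull 𝒞 A := by
  rw [falseAt, comp_χ_iff]
  constructor
  · rintro ⟨l, -⟩
    exact (isNull_nullObj 𝒞).of_hom l
  · intro h
    exact ⟨(h.nonempty_hom _).some, Subsingleton.elim _ _⟩

/-- Reduces disjointness arguments to generalized elements: a truth value is false when it holds
only at null stages. -/
theorem eq_falseAt_iff {A : E} {c : A ⟶ 𝒞.Ω} :
    c = falseAt 𝒞 A ↔ ∀ (B : E) (t : B ⟶ A), t ≫ c = trueAt 𝒞 B → IsNull 𝒞 B := by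
  constructor
  · rintro rfl B t h
    rwa [comp_falseAt, falseAt_eq_trueAt] at h
  · intro h
    apply omega_ext
    intro B t
    rw [comp_falseAt, falseAt_eq_trueAt]
    exact ⟨h B t, fun hB => hB B (𝟙 B) _⟩

end Initial

/-! ### Boolean toposes -/

section Boolean

variable {E : Type u} [Category.{v} E] [IsElementaryTopos E] [IsBoolean E]
  (𝒞 : Subobject.Classifier E)

theorem le_of_factors_arrow {X : E} {R S : Subobject X} (h : S.Factors R.arrow) : R ≤ S :=
  Subobject.le_of_comm (S.factorThru R.arrow h) (S.factorThru_arrow _ h)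

theorem isIso_arrow_of_isTop {X : E} {R : Subobject X} (h : IsTop R) : IsIso R.arrow := by
  rw [Subobject.isIso_arrow_iff_eq_top]
  exact le_antisymm le_top (h ⊤)

/-- In a Boolean topos, equality of maps can be checked by splitting on a truth value. -/
theorem hom_ext_of_bool {A Z : E} (d : A ⟶ 𝒞.Ω) {a b : A ⟶ Z}
    (ht : ∀ (B : E) (t : B ⟶ A), t ≫ d = trueAt 𝒞 B → t ≫ a = t ≫ b)
    (hf : ∀ (B : E) (t : B ⟶ A), t ≫ d = falseAt 𝒞 B → t ≫ a = t ≫ b) : a = b := by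
  have hS : (Subobject.mk (pullback.fst d 𝒞.truth)).arrow ≫ d = trueAt 𝒞 _ := by
    rw [← Subobject.underlyingIso_hom_comp_eq_mk, Category.assoc, pullback.condition, trueAt,
      ← Category.assoc]
    congr 1
    exact Subsingleton.elim _ _
  obtain ⟨D, h1, h2⟩ := IsBoolean.exists_complement _ (Subobject.mk (pullback.fst d 𝒞.truth))
  have hD : D.arrow ≫ d = falseAt 𝒞 _ := by
    rw [eq_falseAt_iff]
    intro B t h
    rw [← Category.assoc] at h
    -- The meet with the complement is a least subobject, hence lies below the one given by the null
    -- object; anything factoring through it is null.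
    have hR := h1 (Subobject.mk (pullback.fst d 𝒞.truth) ⊓ D) inf_le_left inf_le_right
      (Subobject.mk (((isNull_nullObj 𝒞).nonempty_hom A).some))
    have hfac : (Subobject.mk (pullback.fst d 𝒞.truth) ⊓ D).Factors (t ≫ D.arrow) := by
      rw [Subobject.inf_factors]
      refine ⟨?_, Subobject.factors_of_factors_right _ (Subobject.factors_self _)⟩
      rw [Subobject.mk_factors_iff]
      exact ⟨pullback.lift (t ≫ D.arrow) (𝒞.χ₀ B) h, pullback.lift_fst _ _ _⟩
    have := Subobject.factors_of_le _ hR hfac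
    rw [Subobject.mk_factors_iff] at this
    obtain ⟨l, -⟩ := this
    exact (isNull_nullObj 𝒞).of_hom l
  have hE := h2 (equalizerSubobject a b)
    (le_of_factors_arrow (equalizerSubobject_factors a b _ (ht _ _ hS)))
    (le_of_factors_arrow (equalizerSubobject_factors a b _ (hf _ _ hD)))
  have := isIso_arrow_of_isTop hE
  rw [← cancel_epi (equalizerSubobject a b).arrow]
  exact equalizerSubobject_arrow_comp a b

/-- In a Boolean topos, `true` and `false` are jointly epimorphic. -/
theorem bool_hom_ext {Z : E} {a b : 𝒞.Ω ⟶ Z}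
    (ht : trueAt 𝒞 (⊤_ E) ≫ a = trueAt 𝒞 (⊤_ E) ≫ b)
    (hf : falseAt 𝒞 (⊤_ E) ≫ a = falseAt 𝒞 (⊤_ E) ≫ b) : a = b := by
  apply hom_ext_of_bool 𝒞 (𝟙 𝒞.Ω)
  · intro B t h
    rw [Category.comp_id] at h
    rw [h, ← comp_trueAt 𝒞 (terminal.from B), Category.assoc, Category.assoc, ht]
  · intro B t h
    rw [Category.comp_id] at h
    rw [h, ← comp_falseAt 𝒞 (terminal.from B), Category.assoc, Category.assoc, hf]

/-- In a Boolean topos, two disjoint points `t, s : 1 ⟶ W` extend to a map `Ω ⟶ W` which is a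
section of the characteristic map of `t`. -/
theorem exists_extension_of_disjoint {W : E} (t s : ⊤_ E ⟶ W)
    (hts : ∀ B : E, terminal.from B ≫ t = terminal.from B ≫ s → IsNull 𝒞 B) :
    ∃ σ : 𝒞.Ω ⟶ W, trueAt 𝒞 (⊤_ E) ≫ σ = t ∧ σ ≫ 𝒞.χ t = 𝟙 𝒞.Ω := by
  have hst : s ≫ 𝒞.χ t = falseAt 𝒞 _ := by
    rw [eq_falseAt_iff]
    intro B r hr
    rw [← Category.assoc, comp_χ_iff] at hr
    obtain ⟨l, hl⟩ := hr
    apply hts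
    rw [Subsingleton.elim (terminal.from B) l, hl, Subsingleton.elim l r]
  have hts' : t ≫ 𝒞.χ s = falseAt 𝒞 _ := by
    rw [eq_falseAt_iff]
    intro B r hr
    rw [← Category.assoc, comp_χ_iff] at hr
    obtain ⟨l, hl⟩ := hr
    apply hts
    rw [Subsingleton.elim (terminal.from B) l, hl, Subsingleton.elim l r]
  let neg : 𝒞.Ω ⟶ 𝒞.Ω := 𝒞.χ (falseAt 𝒞 (⊤_ E))
  have hnt : trueAt 𝒞 (⊤_ E) ≫ neg = falseAt 𝒞 _ := by
    rw [eq_falseAt_iff]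
    intro B r hr
    rw [← Category.assoc, comp_χ_iff] at hr
    obtain ⟨l, hl⟩ := hr
    rw [comp_trueAt, comp_falseAt, falseAt_eq_trueAt] at hl
    exact hl
  have hnf : falseAt 𝒞 (⊤_ E) ≫ neg = trueAt 𝒞 _ := comp_χ_self 𝒞 _
  -- `Γ` is the set of `w` with `w = s` iff not `w = t`, that is the subobject `{t, s}` of `W`. Its
  -- map to `Ω` is epic since it hits `true` and `false`, and monic since an element of `Γ` is
  -- determined by whether it is `t` or `s`; a topos is balanced.
  let Γ := equalizer (𝒞.χ s) (𝒞.χ t ≫ neg)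
  let p : Γ ⟶ 𝒞.Ω := equalizer.ι _ _ ≫ 𝒞.χ t
  let t' : ⊤_ E ⟶ Γ := equalizer.lift t (by
    rw [hts', ← Category.assoc, comp_χ_self, hnt])
  let s' : ⊤_ E ⟶ Γ := equalizer.lift s (by
    rw [comp_χ_self, ← Category.assoc, hst, hnf])
  have ht' : t' ≫ p = trueAt 𝒞 _ := by
    simp only [t', p, equalizer.lift_ι_assoc, comp_χ_self]
  have hs' : s' ≫ p = falseAt 𝒞 _ := by
    simp only [s', p, equalizer.lift_ι_assoc, hst]
  have : Epi p := by
    constructor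
    intro Z a b h
    apply bool_hom_ext 𝒞
    · rw [← ht', Category.assoc, h, ← Category.assoc]
    · rw [← hs', Category.assoc, h, ← Category.assoc]
  have : Mono p := by
    constructor
    intro A a b h
    have split : ∀ (B : E) (l : B ⟶ Γ), (l ≫ p = trueAt 𝒞 B →
        l ≫ equalizer.ι _ _ = terminal.from B ≫ t) ∧ (l ≫ p = falseAt 𝒞 B →
        l ≫ equalizer.ι _ _ = terminal.from B ≫ s) := by
      intro B l
      constructor
      · intro hl
        rw [← Category.assoc, comp_χ_iff] at hl
        obtain ⟨k, hk⟩ := hl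
        rw [← hk, Subsingleton.elim k]
      · intro hl
        have : (l ≫ equalizer.ι _ _) ≫ 𝒞.χ s = trueAt 𝒞 B := by
          rw [Category.assoc, equalizer.condition, ← Category.assoc, ← Category.assoc,
            Category.assoc l, hl, ← comp_falseAt 𝒞 (terminal.from B), Category.assoc, hnf,
            comp_trueAt]
        rw [comp_χ_iff] at this
        obtain ⟨k, hk⟩ := this
        rw [← hk, Subsingleton.elim k]
    apply hom_ext_of_bool 𝒞 (a ≫ p)
    · intro B r hr
      rw [← cancel_mono (equalizer.ι _ _), (split B (r ≫ a)).1 (by rw [Category.assoc, hr]),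
        (split B (r ≫ b)).1 (by rw [Category.assoc, ← h, hr])]
    · intro B r hr
      rw [← cancel_mono (equalizer.ι _ _), (split B (r ≫ a)).2 (by rw [Category.assoc, hr]),
        (split B (r ≫ b)).2 (by rw [Category.assoc, ← h, hr])]
  have : IsIso p := isIso_of_mono_of_epi p
  refine ⟨inv p ≫ equalizer.ι _ _, ?_, ?_⟩
  · rw [← ht', Category.assoc, IsIso.hom_inv_id_assoc, equalizer.lift_ι]
  · rw [Category.assoc, IsIso.inv_comp_eq, Category.comp_id]

end Boolean

/-! ### Inverse images of connected morphisms: closure under subobjects -/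

section Connected

variable {E : Type u} [Category.{v} E] [IsElementaryTopos E] [IsBoolean E]
  {F : Type u'} [Category.{v'} F] [IsElementaryTopos F]

/-- Transport the characteristic map of `i` along the embedding `σ` of `Ω` into `f^*Ω_F`. By
fullness the result is `f^*c`, and since `σ` is monic and sends `true` to `f^*true`, the subobject
`T` is `f^*` of the one classified by `c`. -/
theorem essImage_of_mono (f : GeometricMorphism E F) (hf : f.IsConnected) {T : E} {X : F}
    (i : T ⟶ f.inverseImage.obj X) [Mono i] : f.inverseImage.essImage T := by
  have := hf.full
  have := hf.faithful
  have := f.preservesFiniteLimits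
  have := f.adj.leftAdjoint_preservesColimits
  obtain ⟨𝒞⟩ := HasSubobjectClassifier.exists_classifier (C := E)
  obtain ⟨𝒟⟩ := HasSubobjectClassifier.exists_classifier (C := F)
  have h1 : IsTerminal (f.inverseImage.obj (⊤_ F)) := terminalIsTerminal.isTerminalObj _ _
  let t : ⊤_ E ⟶ f.inverseImage.obj 𝒟.Ω := h1.from _ ≫ f.inverseImage.map (trueAt 𝒟 _)
  let s : ⊤_ E ⟶ f.inverseImage.obj 𝒟.Ω := h1.from _ ≫ f.inverseImage.map (falseAt 𝒟 _)
  obtain ⟨σ, hσt, hσ⟩ := exists_extension_of_disjoint 𝒞 t s (by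
    intro B h
    -- The equalizer of `true` and `false` in `F` is null, hence initial. Its image under `f^*` is
    -- again initial and again an equalizer, so `t` and `s` can agree only at null stages.
    have hQ : IsNull 𝒟 (equalizer (trueAt 𝒟 (⊤_ F)) (falseAt 𝒟 (⊤_ F))) := by
      rw [← falseAt_eq_trueAt, ← comp_falseAt 𝒟 (equalizer.ι _ _), ← equalizer.condition,
        comp_trueAt]
    have hQ' := isNull_of_isInitial 𝒞 (hQ.nonempty_isInitial.some.isInitialObj f.inverseImage _)
    have hl := isLimitForkMapOfIsLimit f.inverseImage _ (equalizerIsEqualizer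
      (trueAt 𝒟 (⊤_ F)) (falseAt 𝒟 (⊤_ F)))
    exact hQ'.of_hom (Fork.IsLimit.lift hl (terminal.from B ≫ h1.from _)
      (by simpa only [t, s, Category.assoc] using h)))
  have hmono : Mono σ := mono_of_mono_fac (h := 𝟙 _) hσ
  obtain ⟨c, hc⟩ := f.inverseImage.map_surjective (𝒞.χ i ≫ σ)
  have hP := (IsPullback.of_hasPullback c (trueAt 𝒟 (⊤_ F))).map f.inverseImage
  have e1 : f.inverseImage.map (pullback.fst c (trueAt 𝒟 (⊤_ F))) ≫ 𝒞.χ i = trueAt 𝒞 _ := by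
    rw [← cancel_mono σ, Category.assoc, ← hc, hP.w, ← comp_trueAt 𝒞 (terminal.from _),
      Category.assoc, hσt]
    simp only [t, ← Category.assoc]
    congr 1
    exact h1.hom_ext _ _
  have e2 : i ≫ f.inverseImage.map c = h1.from T ≫ f.inverseImage.map (trueAt 𝒟 _) := by
    rw [hc, ← Category.assoc, comp_χ_self, ← comp_trueAt 𝒞 (terminal.from _), Category.assoc, hσt]
    simp only [t, ← Category.assoc]
    congr 1
    exact h1.hom_ext _ _
  obtain ⟨l, hl⟩ := (comp_χ_iff 𝒞 i _).1 e1
  have : Mono (f.inverseImage.map (pullback.fst c (trueAt 𝒟 (⊤_ F)))) := inferInstance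
  exact ⟨pullback c (trueAt 𝒟 (⊤_ F)), ⟨
    { hom := l
      inv := hP.lift i _ e2
      hom_inv_id := by
        rw [← cancel_mono (f.inverseImage.map (pullback.fst c (trueAt 𝒟 (⊤_ F)))),
          Category.assoc, hP.lift_fst, hl, Category.id_comp]
      inv_hom_id := by
        rw [← cancel_mono i, Category.assoc, hl, hP.lift_fst, Category.id_comp] }⟩⟩

/-- The counit of a connected geometric morphism out of a Boolean topos is a monomorphism. -/
theorem mono_counit (f : GeometricMorphism E F) (hf : f.IsConnected) (X : E) :
    Mono (f.adj.counit.app X) := by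
  have := hf.full
  have := hf.faithful
  have := f.preservesFiniteLimits
  let m := prod.lift (pullback.fst (f.adj.counit.app X) (f.adj.counit.app X))
    (pullback.snd (f.adj.counit.app X) (f.adj.counit.app X))
  have hm : Mono m := by
    constructor
    intro A a b h
    apply pullback.hom_ext
    · simpa [m] using congrArg (fun t => t ≫ prod.fst) h
    · simpa [m] using congrArg (fun t => t ≫ prod.snd) h
  -- The kernel pair of the counit is a subobject of `f^*(f_*X × f_*X)`, so it comes from `F`. Its
  -- projections then come from maps into `f_*X`, which agree because their transposes do.
  obtain ⟨K, ⟨e⟩⟩ := essImage_of_mono f hf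
    (m ≫ inv (prodComparison f.inverseImage (f.directImage.obj X) (f.directImage.obj X)))
  have key : e.hom ≫ pullback.fst _ _ = e.hom ≫ pullback.snd _ _ := by
    obtain ⟨a, ha⟩ := f.inverseImage.map_surjective (e.hom ≫ pullback.fst _ _)
    obtain ⟨b, hb⟩ := f.inverseImage.map_surjective (e.hom ≫ pullback.snd _ _)
    have : a = b := by
      apply (f.adj.homEquiv _ _).symm.injective
      rw [f.adj.homEquiv_counit, f.adj.homEquiv_counit, ha, hb, Category.assoc, Category.assoc,
        pullback.condition]
    rw [← ha, ← hb, this]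
  rw [cancel_epi] at key
  exact ⟨fun a b h => by
    rw [← pullback.lift_fst a b h, key, pullback.lift_snd]⟩

end Connected

/-! ### Filters and homomorphisms to the subobject classifier -/

namespace InternalSemilattice

variable {E : Type u} [Category.{v} E] [HasFiniteLimits E] {X : E} (L : InternalSemilattice X)

/-- The meet of generalized elements. -/
def inf {B : E} (x y : B ⟶ X) : B ⟶ X := prod.lift x y ≫ L.meet

theorem comp_inf {A B : E} (t : A ⟶ B) (x y : B ⟶ X) :
    t ≫ L.inf x y = L.inf (t ≫ x) (t ≫ y) := by
  rw [inf, inf, ← Category.assoc, prod.comp_lift]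

theorem comp_meet {B : E} (t : B ⟶ X ⨯ X) :
    t ≫ L.meet = L.inf (t ≫ prod.fst) (t ≫ prod.snd) := by
  rw [inf]
  congr 1
  apply Limits.prod.hom_ext <;> simp

theorem inf_self {B : E} (x : B ⟶ X) : L.inf x x = x := by
  have := congrArg (fun t => x ≫ t) L.meet_self
  simp only [comp_meet, comp_inf, Category.comp_id, ← Category.assoc] at this
  simpa using this

theorem inf_comm {B : E} (x y : B ⟶ X) : L.inf x y = L.inf y x := by
  have := congrArg (fun t => prod.lift x y ≫ t) L.meet_comm
  simp only [comp_meet, comp_inf, ← Category.assoc] at this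
  simpa using this.symm

theorem inf_assoc {B : E} (x y z : B ⟶ X) : L.inf (L.inf x y) z = L.inf x (L.inf y z) := by
  have := congrArg (fun t => prod.lift (prod.lift x y) z ≫ t) L.meet_assoc
  simpa [comp_meet, ← Category.assoc, comp_inf] using this

theorem inf_inf_left_self {B : E} (x y : B ⟶ X) : L.inf (L.inf x y) x = L.inf x y := by
  rw [inf_comm, ← inf_assoc, inf_self]

theorem inf_inf_right_self {B : E} (x y : B ⟶ X) : L.inf (L.inf x y) y = L.inf x y := by
  rw [inf_assoc, inf_self]

end InternalSemilattice

section FilterHom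

variable {E : Type u} [Category.{v} E] [HasFiniteLimits E] {X : E} (L : InternalSemilattice X)

/-- Internal filters in terms of generalized elements. -/
theorem isInternalFilter_iff (F : Subobject X) : IsInternalFilter L F ↔
    F.Factors L.top ∧
    (∀ (B : E) (x y : B ⟶ X), F.Factors x → F.Factors y → F.Factors (L.inf x y)) ∧
    (∀ (B : E) (x y : B ⟶ X), F.Factors x → L.inf x y = x → F.Factors y) := by
  constructor
  · rintro ⟨⟨t, ht⟩, ⟨m, hm⟩, ⟨l, hl⟩⟩
    refine ⟨?_, ?_, ?_⟩
    · rw [← ht]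
      exact Subobject.factors_comp_arrow _
    · intro B x y hx hy
      have : L.inf x y = (prod.lift (F.factorThru x hx) (F.factorThru y hy) ≫ m) ≫ F.arrow := by
        rw [Category.assoc, hm, ← Category.assoc, prod.lift_map, Subobject.factorThru_arrow,
          Subobject.factorThru_arrow, InternalSemilattice.inf]
      rw [this]
      exact Subobject.factors_comp_arrow _
    · intro B x y hx hxy
      let k := equalizer.lift (f := prod.map F.arrow (𝟙 X) ≫ L.meet) (g := prod.fst ≫ F.arrow)
        (prod.lift (F.factorThru x hx) y) (by
          rw [← Category.assoc, prod.lift_map, Subobject.factorThru_arrow, Category.comp_id,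
            prod.lift_fst_assoc, Subobject.factorThru_arrow]
          exact hxy)
      have h1 : k ≫ equalizer.ι _ _ = prod.lift (F.factorThru x hx) y := equalizer.lift_ι _ _
      have h2 := congrArg (fun t => t ≫ prod.snd) h1
      simp only [← hl, Category.assoc, prod.map_snd, prod.lift_snd] at h2
      rw [← h2, ← Category.assoc, ← Category.assoc]
      exact Subobject.factors_comp_arrow _
  · rintro ⟨h1, h2, h3⟩
    refine ⟨⟨F.factorThru _ h1, F.factorThru_arrow _ _⟩, ?_, ?_⟩
    · have h := h2 _ (prod.fst ≫ F.arrow) (prod.snd ≫ F.arrow)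
        (Subobject.factors_comp_arrow _) (Subobject.factors_comp_arrow _)
      refine ⟨F.factorThru _ h, ?_⟩
      rw [F.factorThru_arrow, L.comp_meet, prod.map_fst, prod.map_snd]
    · have aux : ∀ {B : E} (j : B ⟶ (F : E) ⨯ X),
          j ≫ prod.map F.arrow (𝟙 X) ≫ L.meet = j ≫ prod.fst ≫ F.arrow →
          L.inf ((j ≫ prod.fst) ≫ F.arrow) (j ≫ prod.snd) = (j ≫ prod.fst) ≫ F.arrow := by
        intro B j hj
        rw [Category.assoc, ← hj, ← Category.assoc, L.comp_meet, Category.assoc j _ prod.snd,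
          prod.map_snd, Category.comp_id, L.inf_inf_right_self]
      have h := h3 _ ((equalizer.ι (prod.map F.arrow (𝟙 X) ≫ L.meet) (prod.fst ≫ F.arrow) ≫
        prod.fst) ≫ F.arrow)
        (equalizer.ι (prod.map F.arrow (𝟙 X) ≫ L.meet) (prod.fst ≫ F.arrow) ≫ prod.snd)
        (Subobject.factors_comp_arrow _) (aux _ (equalizer.condition _ _))
      refine ⟨prod.lift (equalizer.ι _ _ ≫ prod.fst) (F.factorThru _ h), ?_⟩
      apply Limits.prod.hom_ext
      · simp
      · simp

variable {L} (𝒞 : Subobject.Classifier E)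

theorem comp_χ_arrow_iff {B : E} (F : Subobject X) (t : B ⟶ X) :
    t ≫ 𝒞.χ F.arrow = trueAt 𝒞 B ↔ F.Factors t := by
  constructor
  · intro h
    rw [← (𝒞.isPullback F.arrow).lift_fst t (𝒞.χ₀ B) h]
    exact Subobject.factors_comp_arrow _
  · intro h
    have hw : F.arrow ≫ 𝒞.χ F.arrow = trueAt 𝒞 _ := (𝒞.isPullback F.arrow).w
    rw [← F.factorThru_arrow t h, Category.assoc, hw, comp_trueAt]

/-- The characteristic morphism of an internal filter is a homomorphism. -/
def IsInternalFilter.toHom {F : Subobject X} (hF : IsInternalFilter L F) :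
    SemilatticeHom L (omegaSemilattice 𝒞) where
  hom := 𝒞.χ F.arrow
  map_top := (comp_χ_arrow_iff 𝒞 F _).2 ((isInternalFilter_iff L F).1 hF).1
  map_meet := by
    obtain ⟨-, h2, h3⟩ := (isInternalFilter_iff L F).1 hF
    apply omega_ext
    intro B t
    have e : t ≫ prod.map (𝒞.χ F.arrow) (𝒞.χ F.arrow) ≫ (omegaSemilattice 𝒞).meet =
      (t ≫ prod.map (𝒞.χ F.arrow) (𝒞.χ F.arrow)) ≫ omegaMeet 𝒞 := (Category.assoc _ _ _).symm
    rw [e, comp_omegaMeet, Category.assoc t, prod.map_fst, Category.assoc t,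
      prod.map_snd, ← Category.assoc, comp_χ_arrow_iff, ← Category.assoc, ← Category.assoc, comp_χ_arrow_iff,
      comp_χ_arrow_iff, L.comp_meet]
    constructor
    · intro h
      exact ⟨h3 _ _ _ h (L.inf_inf_left_self _ _), h3 _ _ _ h (L.inf_inf_right_self _ _)⟩
    · rintro ⟨h, h'⟩
      exact h2 _ _ _ h h'

theorem SemilatticeHom.isInternalFilter {F : Subobject X}
    (h : SemilatticeHom L (omegaSemilattice 𝒞)) (hF : 𝒞.χ F.arrow = h.hom) :
    IsInternalFilter L F := by
  have hmeet : ∀ (B : E) (x y : B ⟶ X), F.Factors (L.inf x y) ↔ F.Factors x ∧ F.Factors y := by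
    intro B x y
    have e : prod.lift x y ≫ prod.map h.hom h.hom ≫ (omegaSemilattice 𝒞).meet =
      (prod.lift x y ≫ prod.map h.hom h.hom) ≫ omegaMeet 𝒞 := (Category.assoc _ _ _).symm
    rw [← comp_χ_arrow_iff 𝒞, ← comp_χ_arrow_iff 𝒞, ← comp_χ_arrow_iff 𝒞, hF,
      InternalSemilattice.inf, Category.assoc, h.map_meet, e, comp_omegaMeet]
    simp
  rw [isInternalFilter_iff]
  refine ⟨?_, fun B x y hx hy => (hmeet B x y).2 ⟨hx, hy⟩, fun B x y hx hxy => ?_⟩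
  · rw [← comp_χ_arrow_iff 𝒞, hF]
    exact h.map_top
  · rw [← hxy, hmeet] at hx
    exact hx.2

variable (L) in
/-- Internal filters correspond to homomorphisms to the subobject classifier. -/
def filterEquivHom : InternalFilter L ≃ SemilatticeHom L (omegaSemilattice 𝒞) where
  toFun F := F.2.toHom 𝒞
  invFun h := ⟨𝒞.representableBy.homEquiv h.hom,
    h.isInternalFilter 𝒞 (𝒞.representableBy.homEquiv.symm_apply_apply h.hom)⟩
  left_inv F := Subtype.ext (𝒞.representableBy.homEquiv.apply_symm_apply F.1)
  right_inv h := SemilatticeHom.ext (𝒞.representableBy.homEquiv.symm_apply_apply h.hom)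

end FilterHom

/-! ### The filter of a connected geometric morphism -/

namespace LocalStateClassifier

variable {E : Type u} [Category.{v} E] (𝒮 : LocalStateClassifier E)

/-- A family of maps `X ⟶ Z` compatible with monomorphisms glues to `Ξ ⟶ Z`. -/
def desc {Z : E} (k : ∀ X : E, X ⟶ Z)
    (hk : ∀ (X Y : E) (i : X ⟶ Y) [Mono i], i ≫ k Y = k X) : 𝒮.Ξ ⟶ Z :=
  𝒮.isColimit.desc
    { pt := Z
      ι :=
        { app := fun X => k X.obj
          naturality := fun X Y i => by
            have : Mono i.hom := i.property
            refine (hk X.obj Y.obj i.hom).trans ?_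
            exact (Category.comp_id _).symm } }

theorem ξ_desc {Z : E} (k : ∀ X : E, X ⟶ Z)
    (hk : ∀ (X Y : E) (i : X ⟶ Y) [Mono i], i ≫ k Y = k X) (X : E) :
    𝒮.ξ X ≫ 𝒮.desc k hk = k X :=
  𝒮.isColimit.fac _ ⟨X⟩

/-- The objects `X` such that `ξ_X` factors through a given subobject of `Ξ`. -/
def factorsProp (F : Subobject 𝒮.Ξ) : ObjectProperty E := fun X => F.Factors (𝒮.ξ X)

variable {𝒮}

theorem factorsProp_of_mono {F : Subobject 𝒮.Ξ} {X Y : E} (i : X ⟶ Y) [Mono i]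
    (hY : 𝒮.factorsProp F Y) : 𝒮.factorsProp F X := by
  rw [factorsProp, ← 𝒮.mono_comp_ξ i]
  exact Subobject.factors_of_factors_right _ hY

variable [HasFiniteLimits E]

/-- The largest subobject of `X` belonging to `factorsProp F`. -/
def core (F : Subobject 𝒮.Ξ) (X : E) : Subobject X := (Subobject.pullback (𝒮.ξ X)).obj F

theorem core_factors_iff (F : Subobject 𝒮.Ξ) {B X : E} (t : B ⟶ X) :
    (core F X).Factors t ↔ F.Factors (t ≫ 𝒮.ξ X) :=
  pullback_factors_iff _ _ _

theorem factorsProp_core (F : Subobject 𝒮.Ξ) (X : E) : 𝒮.factorsProp F (core F X : E) := by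
  rw [factorsProp, ← 𝒮.mono_comp_ξ (core F X).arrow, ← core_factors_iff]
  exact Subobject.factors_self _

/-- The maps `ξ_X` are jointly epic, so `F` is determined by its pullbacks along them. Each pullback
is the largest subobject of `X` with the property, hence is determined by the property alone. -/
theorem factorsProp_injective (𝒞 : Subobject.Classifier E) {F F' : Subobject 𝒮.Ξ}
    (h : 𝒮.factorsProp F = 𝒮.factorsProp F') : F = F' := by
  have key : ∀ {F F' : Subobject 𝒮.Ξ}, 𝒮.factorsProp F = 𝒮.factorsProp F' →
      ∀ {B X : E} (t : B ⟶ X), F.Factors (t ≫ 𝒮.ξ X) → F'.Factors (t ≫ 𝒮.ξ X) := by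
    intro F F' h B X t ht
    have h1 := factorsProp_core F X
    rw [h, factorsProp, ← 𝒮.mono_comp_ξ (core F X).arrow] at h1
    rw [← core_factors_iff] at ht
    rw [← Subobject.factorThru_arrow _ _ ht, Category.assoc]
    exact Subobject.factors_of_factors_right _ h1
  apply 𝒞.representableBy.homEquiv.symm.injective
  change 𝒞.χ F.arrow = 𝒞.χ F'.arrow
  apply 𝒮.hom_ext
  intro X
  apply omega_ext
  intro B t
  rw [← Category.assoc, ← Category.assoc, comp_χ_arrow_iff, comp_χ_arrow_iff]
  exact ⟨key h t, key h.symm t⟩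

end LocalStateClassifier

section FilterOfConnected

variable {E : Type u} [Category.{v} E] [IsElementaryTopos E] [IsBoolean E]
  {F : Type u'} [Category.{v'} F] [IsElementaryTopos F]

theorem exists_comp_counit (f : GeometricMorphism E F) {Z X : E}
    (hZ : f.inverseImage.essImage Z) (g : Z ⟶ X) : ∃ l, l ≫ f.adj.counit.app X = g := by
  obtain ⟨K, ⟨e⟩⟩ := hZ
  refine ⟨e.inv ≫ f.inverseImage.map (f.adj.homEquiv _ _ (e.hom ≫ g)), ?_⟩
  have h := (f.adj.homEquiv_counit _ _ _).symm.trans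
    ((f.adj.homEquiv K X).symm_apply_apply (e.hom ≫ g))
  rw [Category.assoc, h, e.inv_hom_id_assoc]

theorem essImage_prod (f : GeometricMorphism E F) {X Y : E} (hX : f.inverseImage.essImage X)
    (hY : f.inverseImage.essImage Y) : f.inverseImage.essImage (X ⨯ Y) := by
  have := f.preservesFiniteLimits
  obtain ⟨K, ⟨e⟩⟩ := hX
  obtain ⟨K', ⟨e'⟩⟩ := hY
  exact ⟨K ⨯ K', ⟨asIso (prodComparison f.inverseImage K K') ≪≫ prod.mapIso e e'⟩⟩

/-- The filter of a connected geometric morphism out of a Boolean topos. -/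
theorem exists_internalFilter (𝒮 : LocalStateClassifier E) (f : GeometricMorphism E F)
    (hf : f.IsConnected) : ∃ G : InternalFilter 𝒮.semilattice,
      f.inverseImage.essImage = 𝒮.factorsProp G.1 := by
  obtain ⟨𝒞⟩ := HasSubobjectClassifier.exists_classifier (C := E)
  have := fun X => mono_counit f hf X
  have := f.preservesFiniteLimits
  let k : ∀ X : E, X ⟶ 𝒞.Ω := fun X => 𝒞.χ (f.adj.counit.app X)
  have hnat : ∀ {X Y B : E} (g : X ⟶ Y) (t : B ⟶ X), t ≫ k X = trueAt 𝒞 B →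
      (t ≫ g) ≫ k Y = trueAt 𝒞 B := by
    intro X Y B g t h
    obtain ⟨l, hl⟩ := (comp_χ_iff 𝒞 _ _).1 h
    refine (comp_χ_iff 𝒞 _ _).2 ⟨l ≫ f.inverseImage.map (f.directImage.map g), ?_⟩
    rw [← hl, Category.assoc, Category.assoc]
    congr 1
    exact f.adj.counit.naturality g
  have hk : ∀ (X Y : E) (i : X ⟶ Y) [Mono i], i ≫ k Y = k X := by
    intro X Y i _
    apply omega_ext
    intro B t
    rw [← Category.assoc]
    refine ⟨fun h => ?_, hnat i t⟩
    obtain ⟨l, hl⟩ := (comp_χ_iff 𝒞 _ _).1 h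
    -- The pullback of the counit of `Y` along `i` is a subobject of `f^*f_*Y`. Closure under
    -- subobjects puts it in the essential image, so its projection to `X` factors through the
    -- counit of `X`.
    obtain ⟨m, hm⟩ := exists_comp_counit f
      (essImage_of_mono f hf (pullback.fst (f.adj.counit.app Y) i))
      (pullback.snd (f.adj.counit.app Y) i)
    exact (comp_χ_iff 𝒞 _ _).2 ⟨pullback.lift l t hl ≫ m, by
      rw [Category.assoc, hm, pullback.lift_snd]⟩
  have hess : ∀ X, k X = trueAt 𝒞 X ↔ f.inverseImage.essImage X := by
    intro X
    rw [← Category.id_comp (k X), comp_χ_iff]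
    constructor
    · rintro ⟨l, hl⟩
      exact ⟨f.directImage.obj X, ⟨⟨f.adj.counit.app X, l, by
        rw [← cancel_mono (f.adj.counit.app X), Category.assoc, hl]
        exact (Category.comp_id _).trans (Category.id_comp _).symm, hl⟩⟩⟩
    · exact fun h => exists_comp_counit f h (𝟙 X)
  let h : SemilatticeHom 𝒮.semilattice (omegaSemilattice 𝒞) :=
    { hom := 𝒮.desc k hk
      map_top := by
        refine (𝒮.ξ_desc k hk _).trans ((hess _).2 ?_)
        exact ⟨⊤_ F, ⟨(terminalIsTerminal.isTerminalObj f.inverseImage _).uniqueUpToIso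
          terminalIsTerminal⟩⟩
      map_meet := by
        apply 𝒮.prod_prod_hom_ext
        intro X Y
        have e1 : prod.map (𝒮.ξ X) (𝒮.ξ Y) ≫ 𝒮.semilattice.meet ≫ 𝒮.desc k hk = k (X ⨯ Y) := by
          rw [← Category.assoc]
          exact (congrArg (fun t => t ≫ 𝒮.desc k hk) (𝒮.map_meet X Y)).trans (𝒮.ξ_desc k hk _)
        have e2 : prod.map (𝒮.ξ X) (𝒮.ξ Y) ≫ prod.map (𝒮.desc k hk) (𝒮.desc k hk) ≫
            (omegaSemilattice 𝒞).meet = prod.map (k X) (k Y) ≫ omegaMeet 𝒞 := by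
          rw [← Category.assoc, prod.map_map, 𝒮.ξ_desc, 𝒮.ξ_desc]
          rfl
        rw [e1, e2]
        apply omega_ext
        intro B t
        rw [← Category.assoc, comp_omegaMeet, Category.assoc, Category.assoc, prod.map_fst,
          prod.map_snd, ← Category.assoc, ← Category.assoc]
        refine ⟨fun h => ⟨hnat _ _ h, hnat _ _ h⟩, ?_⟩
        rintro ⟨h1, h2⟩
        obtain ⟨l1, hl1⟩ := (comp_χ_iff 𝒞 _ _).1 h1
        obtain ⟨l2, hl2⟩ := (comp_χ_iff 𝒞 _ _).1 h2
        obtain ⟨m, hm⟩ := exists_comp_counit f (essImage_prod f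
          (f.inverseImage.obj_mem_essImage (f.directImage.obj X))
          (f.inverseImage.obj_mem_essImage (f.directImage.obj Y)))
          (X := X ⨯ Y) (prod.map (f.adj.counit.app X) (f.adj.counit.app Y))
        refine (comp_χ_iff 𝒞 _ _).2 ⟨prod.lift l1 l2 ≫ m, ?_⟩
        rw [Category.assoc, hm]
        apply Limits.prod.hom_ext
        · simpa using hl1
        · simpa using hl2 }
  refine ⟨(filterEquivHom 𝒮.semilattice 𝒞).symm h, ?_⟩
  ext X
  have e : 𝒞.χ ((filterEquivHom 𝒮.semilattice 𝒞).symm h).1.arrow = h.hom :=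
    congrArg SemilatticeHom.hom ((filterEquivHom 𝒮.semilattice 𝒞).apply_symm_apply h)
  rw [LocalStateClassifier.factorsProp, ← comp_χ_arrow_iff 𝒞, e, ← hess]
  exact Eq.congr_left (𝒮.ξ_desc k hk X).symm

end FilterOfConnected

/-! ### Coreflective subcategories closed under subobjects -/

section Coreflective

variable {E : Type u} [Category.{v} E] [HasFiniteLimits E]

/-- A property of objects closed under subobjects and finite products such that each object has a
largest subobject with the property. -/
structure IsCoreflectiveProp (P : ObjectProperty E) : Prop where
  of_mono : ∀ {X Y : E} (i : X ⟶ Y) [Mono i], P Y → P X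
  terminal : P (⊤_ E)
  prod : ∀ {X Y : E}, P X → P Y → P (X ⨯ Y)
  exists_core : ∀ X : E, ∃ (K : E) (c : K ⟶ X), Mono c ∧ P K ∧
    ∀ (Z : E) (g : Z ⟶ X), P Z → ∃ l, l ≫ c = g

variable {P : ObjectProperty E} (hP : IsCoreflectiveProp P)

namespace IsCoreflectiveProp

include hP

theorem isClosedUnderIsomorphisms : P.IsClosedUnderIsomorphisms where
  of_iso e h := hP.of_mono e.inv h

theorem isClosedUnderFiniteProducts : P.IsClosedUnderFiniteProducts := by
  have := hP.isClosedUnderIsomorphisms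
  have : P.IsClosedUnderLimitsOfShape (Discrete.{0} PEmpty) :=
    ⟨by
      rintro X ⟨p⟩
      have : Mono (terminal.from X) := ⟨fun a b _ => p.isLimit.hom_ext fun j => j.as.elim⟩
      exact hP.of_mono (terminal.from X) hP.terminal⟩
  have : P.IsClosedUnderBinaryProducts :=
    ⟨by
      rintro X ⟨p⟩
      let m : X ⟶ p.diag.obj ⟨.left⟩ ⨯ p.diag.obj ⟨.right⟩ :=
        prod.lift (p.π.app ⟨.left⟩) (p.π.app ⟨.right⟩)
      have : Mono m := ⟨fun a b h => p.isLimit.hom_ext fun j => by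
        rcases j with ⟨_ | _⟩
        · simpa [m] using congrArg (fun t => t ≫ prod.fst) h
        · simpa [m] using congrArg (fun t => t ≫ prod.snd) h⟩
      exact hP.of_mono m (hP.prod (p.prop_diag_obj _) (p.prop_diag_obj _))⟩
  exact ObjectProperty.IsClosedUnderFiniteProducts.mk'

/-- A limit embeds into the product of the objects of its diagram. -/
theorem isClosedUnderLimitsOfShape (J : Type) [SmallCategory J] [FinCategory J] :
    P.IsClosedUnderLimitsOfShape J where
  limitsOfShape_le := by
    have := hP.isClosedUnderFiniteProducts
    rintro X ⟨p⟩
    let m : X ⟶ ∏ᶜ p.diag.obj := Pi.lift fun j => p.π.app j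
    have : Mono m := ⟨fun a b h => p.isLimit.hom_ext fun j => by
      simpa [m] using congrArg (fun t => t ≫ Pi.π _ j) h⟩
    exact hP.of_mono m (P.prop_product p.prop_diag_obj)

theorem hasFiniteLimits : HasFiniteLimits P.FullSubcategory where
  out J _ _ := by
    have := hP.isClosedUnderLimitsOfShape J
    infer_instance

theorem preservesFiniteLimits_ι : PreservesFiniteLimits P.ι where
  preservesFiniteLimits J _ _ := by
    have := hP.isClosedUnderLimitsOfShape J
    infer_instance

theorem isLeftAdjoint_ι : P.ι.IsLeftAdjoint := by
  choose K c hc hK l hl using hP.exists_core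
  let e : ∀ (X : P.FullSubcategory) (Y : E), (P.ι.obj X ⟶ Y) ≃ (X ⟶ ⟨K Y, hK Y⟩) := fun X Y =>
    { toFun := fun g => ObjectProperty.homMk (l Y X.obj g X.property)
      invFun := fun g => g.hom ≫ c Y
      left_inv := fun g => hl Y X.obj g X.property
      right_inv := fun g => by
        ext
        have := hc Y
        rw [← cancel_mono (c Y)]
        exact hl Y X.obj _ X.property }
  exact (Adjunction.adjunctionOfEquivRight e (fun X' X Y f g => by
    apply (e X' Y).symm.injective
    rw [Equiv.symm_apply_apply]
    change _ = (f ≫ e X Y g).hom ≫ c Y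
    rw [ObjectProperty.FullSubcategory.comp_hom, Category.assoc]
    exact congrArg (fun t => f.hom ≫ t) (hl Y X.obj g X.property).symm)).isLeftAdjoint

/-- The classifier is the largest subobject `K` of `Ω` with the property: characteristic maps on
objects of the subcategory factor uniquely through it. -/
theorem hasSubobjectClassifier [HasSubobjectClassifier E] :
    HasSubobjectClassifier P.FullSubcategory := by
  have := hP.hasFiniteLimits
  have := hP.preservesFiniteLimits_ι
  obtain ⟨𝒞⟩ := HasSubobjectClassifier.exists_classifier (C := E)
  obtain ⟨K, c, hc, hK, hl⟩ := hP.exists_core 𝒞.Ω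
  choose l hl using hl
  let tr : (⟨⊤_ E, hP.terminal⟩ : P.FullSubcategory) ⟶ ⟨K, hK⟩ :=
    ObjectProperty.homMk (l _ (trueAt 𝒞 (⊤_ E)) hP.terminal)
  have htr : tr.hom ≫ c = trueAt 𝒞 _ := hl _ _ _
  let ht : IsTerminal (⟨⊤_ E, hP.terminal⟩ : P.FullSubcategory) :=
    IsTerminal.ofUniqueHom (fun X => ObjectProperty.homMk (terminal.from X.obj))
      (fun X m => by ext)
  -- Since `true` factors through the monomorphism `c`, it is the pullback of itself along `c`;
  -- squares over `K` and over `Ω` are therefore pullbacks simultaneously.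
  have pb : ∀ {U X : P.FullSubcategory} (m : U ⟶ X) (k : X ⟶ ⟨K, hK⟩),
      IsPullback m (ht.from U) k tr ↔ IsPullback m.hom (𝒞.χ₀ _) (k.hom ≫ c) 𝒞.truth := by
    intro U X m k
    have h1 : IsPullback tr.hom (𝒞.χ₀ _) c 𝒞.truth :=
      IsPullback.of_isLimit' ⟨htr⟩ (PullbackCone.IsLimit.mk _ (fun s => terminal.from _)
        (fun s => by
          rw [← cancel_mono c, Category.assoc, htr, comp_trueAt, s.condition, trueAt]
          congr 1
          exact Subsingleton.elim _ _)
        (fun s => Subsingleton.elim _ _) (fun s m _ _ => Subsingleton.elim _ _))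
    constructor
    · intro h
      have h2 := (h.map P.ι).paste_vert h1
      exact Subsingleton.elim (P.ι.map (ht.from U) ≫ 𝒞.χ₀ (⊤_ E)) (𝒞.χ₀ U.obj) ▸ h2
    · intro h
      have h2 : m.hom ≫ k.hom = (ht.from U).hom ≫ tr.hom := by
        rw [← cancel_mono c, Category.assoc, Category.assoc, htr, comp_trueAt]
        exact h.w
      rw [Subsingleton.elim (𝒞.χ₀ _) ((ht.from U).hom ≫ 𝒞.χ₀ _)] at h
      exact IsPullback.of_map P.ι (by ext; exact h2) (IsPullback.of_bot h h2 h1)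
  exact ⟨⟨Subobject.Classifier.mkOfTerminalΩ₀ _ ht ⟨K, hK⟩ tr
    (fun {U X} m _ => ObjectProperty.homMk (l _ (𝒞.χ (P.ι.map m)) X.property))
    (fun {U X} m _ => by
      rw [pb]
      exact (hl _ (𝒞.χ (P.ι.map m)) X.property).symm ▸ 𝒞.isPullback (P.ι.map m))
    (fun {U X} m _ k hk => by
      rw [pb] at hk
      ext
      rw [← cancel_mono c]
      exact (𝒞.uniq (P.ι.map m) hk).trans (hl _ (𝒞.χ (P.ι.map m)) X.property).symm)⟩⟩

/-- Exponentials are coreflections of exponentials in `E`: `Y ↦ X × Y`, as a functor into `E`, is a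
composite of left adjoints, and it takes values in the subcategory. -/
theorem isElementaryTopos [IsElementaryTopos E] : IsElementaryTopos P.FullSubcategory := by
  have := hP.hasFiniteLimits
  have := hP.preservesFiniteLimits_ι
  refine ⟨hP.hasFiniteLimits, hP.hasSubobjectClassifier, fun X => ?_⟩
  have := hP.isLeftAdjoint_ι
  let L : P.FullSubcategory ⥤ E := P.ι ⋙ prod.functor.obj X.obj
  let i : 𝟭 _ ⋙ L ≅ prod.functor.obj X ⋙ P.ι := NatIso.ofComponents
    (fun Y => (asIso (prodComparison P.ι X Y)).symm) (fun {Y Z} f => by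
      change prod.map (𝟙 X.obj) (P.ι.map f) ≫ inv (prodComparison P.ι X Z) =
        inv (prodComparison P.ι X Y) ≫ P.ι.map (prod.map (𝟙 X) f)
      rw [IsIso.comp_inv_eq, Category.assoc, prodComparison_natural, IsIso.eq_inv_comp]
      simp
      )
  have : L.IsLeftAdjoint := inferInstance
  exact ((Adjunction.ofIsLeftAdjoint L).restrictFullyFaithful (Functor.FullyFaithful.id _)
    P.fullyFaithfulι i (Functor.rightUnitor (P.ι ⋙ L.rightAdjoint)).symm).isLeftAdjoint

end IsCoreflectiveProp

/-- The connected geometric morphism onto a coreflective subcategory closed under subobjects and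
finite products. -/
def IsCoreflectiveProp.morphism [IsElementaryTopos E] (hP : IsCoreflectiveProp P) :
    ConnectedMorphismFrom E :=
  haveI := hP.isElementaryTopos
  haveI := hP.isLeftAdjoint_ι
  { codomain := P.FullSubcategory
    morphism :=
      { directImage := P.ι.rightAdjoint
        inverseImage := P.ι
        adj := Adjunction.ofIsLeftAdjoint P.ι
        preservesFiniteLimits := hP.preservesFiniteLimits_ι }
    isConnected := ⟨P.full_ι, P.faithful_ι⟩ }

theorem IsCoreflectiveProp.essImage_morphism [IsElementaryTopos E] (hP : IsCoreflectiveProp P) :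
    hP.morphism.morphism.inverseImage.essImage = P := by
  have := hP.isClosedUnderIsomorphisms
  ext X
  refine ⟨?_, fun h => ⟨⟨X, h⟩, ⟨Iso.refl _⟩⟩⟩
  rintro ⟨K, ⟨e⟩⟩
  exact P.prop_of_iso e K.property

end Coreflective

/-! ### The classification -/

section Classification

variable {E : Type u} [Category.{v} E]

theorem isCoreflectiveProp_factorsProp [IsElementaryTopos E] {𝒮 : LocalStateClassifier E}
    (G : InternalFilter 𝒮.semilattice) : IsCoreflectiveProp (𝒮.factorsProp G.1) := by
  obtain ⟨h1, h2, h3⟩ := (isInternalFilter_iff _ _).1 G.2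
  have hprod : ∀ {B X Y : E} (a : B ⟶ X) (b : B ⟶ Y),
      𝒮.semilattice.inf (a ≫ 𝒮.ξ X) (b ≫ 𝒮.ξ Y) = prod.lift a b ≫ 𝒮.ξ (X ⨯ Y) := by
    intro B X Y a b
    rw [InternalSemilattice.inf, ← 𝒮.map_meet, ← Category.assoc, prod.lift_map]
    rfl
  refine ⟨fun i _ h => LocalStateClassifier.factorsProp_of_mono i h, h1, ?_, fun X => ?_⟩
  · intro X Y hX hY
    have := h2 _ (prod.fst ≫ 𝒮.ξ X) (prod.snd ≫ 𝒮.ξ Y)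
      (Subobject.factors_of_factors_right _ hX) (Subobject.factors_of_factors_right _ hY)
    rw [hprod, prod.lift_fst_snd, Category.id_comp] at this
    exact this
  · refine ⟨_, (LocalStateClassifier.core G.1 X).arrow, inferInstance,
      LocalStateClassifier.factorsProp_core _ _, fun Z g hZ => ?_⟩
    -- The graph of `g` is monic, so `ξ_Z ∧ (ξ_X ∘ g) = ξ_Z` and upward closure applies.
    have : Mono (prod.lift (𝟙 Z) g) := mono_of_mono_fac (h := 𝟙 Z) (prod.lift_fst _ _)
    have h := h3 _ (𝒮.ξ Z) (g ≫ 𝒮.ξ X) hZ (by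
      have := hprod (𝟙 Z) g
      rwa [Category.id_comp, 𝒮.mono_comp_ξ (prod.lift (𝟙 Z) g)] at this)
    rw [← LocalStateClassifier.core_factors_iff] at h
    exact ⟨_, Subobject.factorThru_arrow _ _ h⟩

/-- Fully faithful functors with the same essential image differ by an equivalence; uniqueness of
right adjoints carries this to direct images. -/
theorem GeometricMorphism.identified_of_essImage_eq {F : Type*} [Category* F] {G : Type*}
    [Category* G] {f : GeometricMorphism E F} {g : GeometricMorphism E G} (hf : f.IsConnected)
    (hg : g.IsConnected) (h : f.inverseImage.essImage = g.inverseImage.essImage) :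
    f.Identified g := by
  have := hf.full
  have := hf.faithful
  have := hg.full
  have := hg.faithful
  have hmem : ∀ X, g.inverseImage.essImage (f.inverseImage.obj X) := fun X =>
    h ▸ f.inverseImage.obj_mem_essImage X
  let L : F ⥤ G := Functor.essImage.liftFunctor f.inverseImage g.inverseImage hmem
  let i : L ⋙ g.inverseImage ≅ f.inverseImage :=
    Functor.essImage.liftFunctorCompIso f.inverseImage g.inverseImage hmem
  have hff : L.FullyFaithful := Functor.FullyFaithful.ofCompFaithful (G := g.inverseImage)
    ((Functor.FullyFaithful.ofFullyFaithful f.inverseImage).ofIso i.symm)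
  have := hff.full
  have := hff.faithful
  have : L.EssSurj := ⟨fun Y => by
    have hY : f.inverseImage.essImage (g.inverseImage.obj Y) :=
      h ▸ g.inverseImage.obj_mem_essImage Y
    obtain ⟨X, ⟨e⟩⟩ := hY
    exact ⟨X, ⟨g.inverseImage.preimageIso (i.app X ≪≫ e)⟩⟩⟩
  have : L.IsEquivalence := { }
  let e := L.asEquivalence
  have adj : e.inverse ⋙ f.inverseImage ⊣ f.directImage ⋙ e.functor :=
    e.symm.toAdjunction.comp f.adj
  let j : e.inverse ⋙ f.inverseImage ≅ g.inverseImage :=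
    Functor.isoWhiskerLeft e.inverse i.symm ≪≫ (Functor.associator _ _ _).symm ≪≫
      Functor.isoWhiskerRight e.counitIso g.inverseImage ≪≫ Functor.leftUnitor _
  exact ⟨e, ⟨(adj.ofNatIsoLeft j).rightAdjointUniq g.adj⟩⟩

theorem GeometricMorphism.Identified.essImage_eq {F : Type*} [Category* F] {G : Type*}
    [Category* G] {f : GeometricMorphism E F} {g : GeometricMorphism E G} (h : f.Identified g) :
    f.inverseImage.essImage = g.inverseImage.essImage := by
  obtain ⟨e, ⟨i⟩⟩ := h
  have adj : e.inverse ⋙ f.inverseImage ⊣ f.directImage ⋙ e.functor :=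
    e.symm.toAdjunction.comp f.adj
  let j : e.inverse ⋙ f.inverseImage ≅ g.inverseImage :=
    (adj.ofNatIsoRight i).leftAdjointUniq g.adj
  ext X
  constructor
  · rintro ⟨K, ⟨k⟩⟩
    exact ⟨e.functor.obj K, ⟨(j.app _).symm ≪≫ f.inverseImage.mapIso (e.unitIso.app K).symm ≪≫ k⟩⟩
  · rintro ⟨K, ⟨k⟩⟩
    exact ⟨e.inverse.obj K, ⟨j.app K ≪≫ k⟩⟩

variable [IsElementaryTopos E] [IsBoolean E]

theorem exists_quotientEquivFilter (𝒮 : LocalStateClassifier E) :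
    ∃ α : QuotientOf E ≃ InternalFilter 𝒮.semilattice, ∀ q : ConnectedMorphismFrom E,
      q.morphism.inverseImage.essImage = 𝒮.factorsProp (α q.toQuotient).1 := by
  obtain ⟨𝒞⟩ := HasSubobjectClassifier.exists_classifier (C := E)
  choose φ hφ using fun q : ConnectedMorphismFrom E =>
    exists_internalFilter 𝒮 q.morphism q.isConnected
  have hinj : ∀ {G G' : InternalFilter 𝒮.semilattice},
      𝒮.factorsProp G.1 = 𝒮.factorsProp G'.1 → G = G' := fun h =>
    Subtype.ext (LocalStateClassifier.factorsProp_injective 𝒞 h)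
  let ψ : QuotientOf E → InternalFilter 𝒮.semilattice := Quotient.lift φ fun p q h =>
    hinj ((hφ p).symm.trans ((GeometricMorphism.Identified.essImage_eq h).trans (hφ q)))
  refine ⟨Equiv.ofBijective ψ ⟨?_, ?_⟩, hφ⟩
  · rintro ⟨p⟩ ⟨q⟩ h
    refine Quotient.sound (GeometricMorphism.identified_of_essImage_eq p.isConnected
      q.isConnected ?_)
    have h' : φ p = φ q := h
    rw [hφ, hφ, h']
  · intro G
    refine ⟨(isCoreflectiveProp_factorsProp G).morphism.toQuotient, hinj ?_⟩
    exact (hφ _).symm.trans (isCoreflectiveProp_factorsProp G).essImage_morphism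

/-- Connected geometric morphisms to toposes in arbitrary universes are identified with
morphisms to toposes in the universes of the domain. -/
theorem exists_identified (𝒮 : LocalStateClassifier E) {F : Type u'} [Category.{v'} F]
    [IsElementaryTopos F] (f : GeometricMorphism E F) (hf : f.IsConnected) :
    ∃ q : ConnectedMorphismFrom E, f.Identified q.morphism := by
  obtain ⟨G, hG⟩ := exists_internalFilter 𝒮 f hf
  exact ⟨_, GeometricMorphism.identified_of_essImage_eq hf
    (isCoreflectiveProp_factorsProp G).morphism.isConnected
    (hG.trans (isCoreflectiveProp_factorsProp G).essImage_morphism.symm)⟩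

theorem small_quotientOf (𝒮 : LocalStateClassifier E) [LocallySmall.{w} E] :
    Small.{w} (QuotientOf E) := by
  obtain ⟨𝒞⟩ := HasSubobjectClassifier.exists_classifier (C := E)
  obtain ⟨α, -⟩ := exists_quotientEquivFilter 𝒮
  have : Function.Injective fun h : SemilatticeHom 𝒮.semilattice (omegaSemilattice 𝒞) => h.hom :=
    fun _ _ h => SemilatticeHom.ext h
  have := small_of_injective.{w} this
  exact small_of_injective.{w} (α.trans (filterEquivHom _ 𝒞)).injective

end Classification

/-! ### Transport along equivalences -/

section Transport

variable {E : Type u} [Category.{v} E] {S : Type u'} [Category.{v'} S]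

theorem isElementaryTopos_of_equivalence (e : E ≌ S) [IsElementaryTopos S] :
    IsElementaryTopos E := by
  have hfl : HasFiniteLimits E :=
    ⟨fun J _ _ => Adjunction.hasLimitsOfShape_of_equivalence e.functor⟩
  obtain ⟨𝒞⟩ := HasSubobjectClassifier.exists_classifier (C := S)
  refine ⟨hfl, ⟨⟨𝒞.ofEquivalence e.symm⟩⟩, fun X => ?_⟩
  let c : ∀ Y, e.functor.obj (X ⨯ Y) ≅ e.functor.obj X ⨯ e.functor.obj Y := fun Y =>
    asIso (prodComparison e.functor X Y)
  let i : prod.functor.obj X ⋙ e.functor ≅ e.functor ⋙ prod.functor.obj (e.functor.obj X) :=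
    NatIso.ofComponents c (fun {Y Z} f => by
      have := prodComparison_natural e.functor (𝟙 X) f
      rw [e.functor.map_id] at this
      exact this)
  let j : (e.functor ⋙ prod.functor.obj (e.functor.obj X)) ⋙ e.inverse ≅ prod.functor.obj X :=
    Functor.isoWhiskerRight i.symm e.inverse ≪≫ Functor.associator _ _ _ ≪≫
      Functor.isoWhiskerLeft _ e.unitIso.symm ≪≫ Functor.rightUnitor _
  exact Functor.isLeftAdjoint_of_iso j

/-- A local state classifier from its universal property. -/
theorem nonempty_localStateClassifier (Ξ : E) (ξ : ∀ X : E, X ⟶ Ξ)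
    (hξ : ∀ (X Y : E) (i : X ⟶ Y) [Mono i], i ≫ ξ Y = ξ X)
    (h : ∀ (Z : E) (k : ∀ X : E, X ⟶ Z), (∀ (X Y : E) (i : X ⟶ Y) [Mono i], i ≫ k Y = k X) →
      ∃! d : Ξ ⟶ Z, ∀ X, ξ X ≫ d = k X) : Nonempty (LocalStateClassifier E) := by
  have hs : ∀ s : Cocone (wideSubcategoryInclusion (MorphismProperty.monomorphisms E)),
      ∀ (X Y : E) (i : X ⟶ Y) [Mono i], i ≫ s.ι.app ⟨Y⟩ = s.ι.app ⟨X⟩ := fun s X Y i _ =>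
    s.w (show (⟨X⟩ : WideSubcategory (MorphismProperty.monomorphisms E)) ⟶ ⟨Y⟩ from
      ⟨i, MorphismProperty.monomorphisms.infer_property i⟩)
  choose d hd hu using fun s : Cocone
    (wideSubcategoryInclusion (MorphismProperty.monomorphisms E)) => h s.pt _ (hs s)
  exact ⟨{
    cocone :=
      { pt := Ξ
        ι :=
          { app := fun X => ξ X.obj
            naturality := fun X Y i => by
              have : Mono i.hom := i.property
              refine (hξ X.obj Y.obj i.hom).trans ?_
              exact (Category.comp_id _).symm } }
    isColimit :=
      { desc := d
        fac := fun s X => hd s X.obj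
        uniq := fun s m hm => hu s m fun X => hm ⟨X⟩ } }⟩

theorem nonempty_localStateClassifier_of_equivalence (e : E ≌ S)
    (𝒮 : LocalStateClassifier S) : Nonempty (LocalStateClassifier E) := by
  refine nonempty_localStateClassifier (e.inverse.obj 𝒮.Ξ)
    (fun X => e.unit.app X ≫ e.inverse.map (𝒮.ξ (e.functor.obj X))) ?_ ?_
  · intro X Y i _
    rw [← Category.assoc, ← e.unit_naturality, Category.assoc, ← e.inverse.map_comp,
      𝒮.mono_comp_ξ]
  · intro Z k hk
    let k' : ∀ Y : S, Y ⟶ e.functor.obj Z := fun Y =>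
      e.counitInv.app Y ≫ e.functor.map (k (e.inverse.obj Y))
    have hk' : ∀ (X Y : S) (i : X ⟶ Y) [Mono i], i ≫ k' Y = k' X := by
      intro X Y i _
      simp only [k']
      rw [← hk _ _ (e.inverse.map i), e.functor.map_comp, ← Category.assoc, ← Category.assoc]
      congr 1
      exact e.counitInv.naturality i
    -- Being a factorization of `k` corresponds under transposition to being the map glued from
    -- `k'`; existence and uniqueness follow at once.
    have key : ∀ d : e.inverse.obj 𝒮.Ξ ⟶ Z,
        (∀ X, (e.unit.app X ≫ e.inverse.map (𝒮.ξ (e.functor.obj X))) ≫ d = k X) ↔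
        e.symm.toAdjunction.homEquiv _ _ d = 𝒮.desc k' hk' := by
      intro d
      rw [Adjunction.homEquiv_unit]
      change _ ↔ e.counitInv.app 𝒮.Ξ ≫ e.functor.map d = 𝒮.desc k' hk'
      have e1 : ∀ Y, 𝒮.ξ Y ≫ e.counitInv.app 𝒮.Ξ ≫ e.functor.map d =
          e.counitInv.app Y ≫ e.functor.map (e.inverse.map (𝒮.ξ Y) ≫ d) := by
        intro Y
        rw [e.functor.map_comp, ← Category.assoc, ← Category.assoc]
        congr 1
        exact e.counitInv.naturality (𝒮.ξ Y)
      constructor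
      · intro h
        apply 𝒮.hom_ext
        intro Y
        rw [𝒮.ξ_desc, e1]
        simp only [k']
        have e2 : e.counitInv.app Y ≫ 𝒮.ξ (e.functor.obj (e.inverse.obj Y)) = 𝒮.ξ Y :=
          𝒮.mono_comp_ξ (e.counitInv.app Y)
        rw [← h, e.unit_app_inverse, ← e.inverse.map_comp, e2]
      · intro h X
        have h1 := congrArg (fun t => 𝒮.ξ (e.functor.obj X) ≫ t) h
        simp only [e1, 𝒮.ξ_desc, k'] at h1
        rw [cancel_epi] at h1
        have h2 := e.functor.map_injective h1
        rw [Category.assoc, h2]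
        exact hk _ _ (e.unit.app X)
    refine ⟨(e.symm.toAdjunction.homEquiv _ _).symm (𝒮.desc k' hk'),
      (key _).2 (Equiv.apply_symm_apply _ _), fun d hd => ?_⟩
    rw [Equiv.eq_symm_apply]
    exact (key d).1 hd

end Transport

/-! ### Sheaf toposes -/

section Sheaves

variable {C : Type w} [SmallCategory C] (J : GrothendieckTopology C)

instance : IsElementaryTopos (Sheaf J (Type w)) where
  hasFiniteLimits := inferInstance
  hasSubobjectClassifier := inferInstance
  isLeftAdjoint_prod X :=
    haveI : Closed X := inferInstance
    @CartesianMonoidalCategory.isLeftAdjoint_prod_functor _ _ inferInstance X this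

/-- The pairs of restrictions that identify a section of a presheaf. -/
def sectionRel {P : Cᵒᵖ ⥤ Type w} {U : Cᵒᵖ} (x : P.obj U) :
    Set (Σ V : Cᵒᵖ, (U ⟶ V) × (U ⟶ V)) :=
  {p | P.map p.2.1 x = P.map p.2.2 x}

theorem sectionRel_map {P : Cᵒᵖ ⥤ Type w} {U U' : Cᵒᵖ} (g : U ⟶ U') (x : P.obj U) :
    sectionRel (P.map g x) = {p | (⟨p.1, g ≫ p.2.1, g ≫ p.2.2⟩ :
      Σ V : Cᵒᵖ, (U ⟶ V) × (U ⟶ V)) ∈ sectionRel x} := by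
  ext p
  simp [sectionRel]

theorem sectionRel_app {P Q : Cᵒᵖ ⥤ Type w} (i : P ⟶ Q)
    (hi : ∀ V, Function.Injective (i.app V)) {U : Cᵒᵖ} (x : P.obj U) :
    sectionRel (i.app U x) = sectionRel x := by
  ext p
  simp only [sectionRel, Set.mem_ofPred_eq, ← NatTrans.naturality_apply]
  exact (hi _).eq_iff

/-- The presheaf of relations `sectionRel x` on sections of sheaves. -/
def sectionRelPresheaf : Cᵒᵖ ⥤ Type w where
  -- The sheaf `X` ranges over a large class, but only its existence is recorded, so the values stay
  -- in `Type w`.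
  obj U := {R : Set (Σ V : Cᵒᵖ, (U ⟶ V) × (U ⟶ V)) //
    ∃ (X : Sheaf J (Type w)) (x : X.obj.obj U), sectionRel x = R}
  map {U U'} g := ↾fun R => ⟨{p | (⟨p.1, g ≫ p.2.1, g ≫ p.2.2⟩ :
      Σ V : Cᵒᵖ, (U ⟶ V) × (U ⟶ V)) ∈ R.1}, by
    obtain ⟨_, X, x, rfl⟩ := R
    exact ⟨X, X.obj.map g x, sectionRel_map g x⟩⟩
  map_id U := by
    refine ConcreteCategory.hom_ext _ _ fun R => Subtype.ext ?_
    simp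
  map_comp f g := by
    refine ConcreteCategory.hom_ext _ _ fun R => Subtype.ext ?_
    simp

/-- The map sending a section `x` to `sectionRel x`. -/
def toSectionRel (X : Sheaf J (Type w)) : X.obj ⟶ sectionRelPresheaf J where
  app U := ↾fun x => ⟨sectionRel x, X, x, rfl⟩
  naturality U V g := by
    exact ConcreteCategory.hom_ext _ _ fun x => Subtype.ext (sectionRel_map g x)

variable {J}

theorem injective_of_mono {X Y : Sheaf J (Type w)} (i : X ⟶ Y) [Mono i] (U : Cᵒᵖ) :
    Function.Injective (i.hom.app U) := by
  have h1 : Mono ((sheafToPresheaf J (Type w)).map i) := inferInstance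
  have h2 : Mono (((sheafToPresheaf J (Type w)).map i).app U) := inferInstance
  exact (mono_iff_injective _).1 h2

/-- Sections with the same relation generate isomorphic subsheaves. -/
theorem exists_common_subsheaf {X Y : Sheaf J (Type w)} {U : Cᵒᵖ} (x : X.obj.obj U)
    (y : Y.obj.obj U) (h : sectionRel x = sectionRel y) :
    ∃ (H : Sheaf J (Type w)) (z : H.obj.obj U) (a : H ⟶ X) (b : H ⟶ Y),
      Mono a ∧ Mono b ∧ a.hom.app U z = x ∧ b.hom.app U z = y := by
  have hX := (isSheaf_iff_isSheaf_of_type J X.obj).1 X.property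
  have hY := (isSheaf_iff_isSheaf_of_type J Y.obj).1 Y.property
  have hxy : ∀ {V : Cᵒᵖ} (f g : U ⟶ V), X.obj.map f x = X.obj.map g x ↔
      Y.obj.map f y = Y.obj.map g y := fun {V} f g =>
    Set.ext_iff.1 h (⟨V, f, g⟩ : Σ V : Cᵒᵖ, (U ⟶ V) × (U ⟶ V))
  let G := Subfunctor.ofSection x
  -- Sends the restriction of `x` along `f` to that of `y`; equality of the relations makes it well
  -- defined and injective.
  let φ : G.toFunctor ⟶ Y.obj :=
    { app := fun V => ↾fun s => Y.obj.map s.2.choose y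
      naturality := fun V W g => by
        refine ConcreteCategory.hom_ext _ _ fun s => ?_
        change Y.obj.map _ y = Y.obj.map g (Y.obj.map _ y)
        rw [← Functor.map_comp_apply, ← hxy]
        refine (G.toFunctor.map g s).2.choose_spec.trans ?_
        rw [Functor.map_comp_apply, s.2.choose_spec]
        rfl }
  have hφ : ∀ {V : Cᵒᵖ} (f : U ⟶ V) (s : G.toFunctor.obj V), s.1 = X.obj.map f x →
      φ.app V s = Y.obj.map f y := by
    intro V f s hs
    exact (hxy _ _).1 (s.2.choose_spec.trans hs)
  have hφi : ∀ V, Function.Injective (φ.app V) := by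
    intro V s t hst
    have := (hxy _ _).2 hst
    rw [s.2.choose_spec, t.2.choose_spec] at this
    exact Subtype.ext this
  let H : Sheaf J (Type w) := ⟨(G.sheafify J).toFunctor,
    (isSheaf_iff_isSheaf_of_type J _).2 (G.sheafify_isSheaf hX)⟩
  let a : H ⟶ X := ⟨(G.sheafify J).ι⟩
  let b : H ⟶ Y := ⟨G.sheafifyLift φ hY⟩
  let z' : G.toFunctor.obj U := ⟨x, Subfunctor.mem_ofSection_obj x⟩
  let z : H.obj.obj U := (Subfunctor.homOfLe (G.le_sheafify J)).app U z'
  have hb : ∀ {V : Cᵒᵖ} (s : G.toFunctor.obj V),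
      b.hom.app V ((Subfunctor.homOfLe (G.le_sheafify J)).app V s) = φ.app V s := by
    intro V s
    exact ConcreteCategory.congr_hom (congr_app (G.to_sheafifyLift φ hY) V) s
  refine ⟨H, z, a, b, ?_, ?_, rfl, ?_⟩
  · apply Sheaf.Hom.mono_of_presheaf_mono
  · apply Sheaf.mono_of_injective
    intro V s t hst
    apply Subtype.ext
    -- Two sections of the closure of `G` lie in `G` on a common cover; there `φ` is injective, and
    -- `X` is separated.
    apply ((hX _ (J.intersection_covering s.2 t.2)).isSeparatedFor).ext
    rintro W i ⟨hs, ht⟩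
    have e : φ.app _ ⟨_, hs⟩ = φ.app _ ⟨_, ht⟩ := by
      refine (hb _).symm.trans (Eq.trans ?_ (hb _))
      have e1 := (NatTrans.naturality_apply b.hom i.op s).trans
        ((congrArg (Y.obj.map i.op) hst).trans (NatTrans.naturality_apply b.hom i.op t).symm)
      exact e1
    exact congrArg Subtype.val (hφi _ e)
  · rw [hb z', hφ (𝟙 U) z' (by simp [z'])]
    simp

/-- A cocone over monomorphisms takes equal values on sections with the same relation, since both
come from one section of a common subsheaf. It thus factors uniquely through the presheaf of
relations, and then through its sheafification. -/
theorem nonempty_localStateClassifier_sheaf : Nonempty (LocalStateClassifier (Sheaf J (Type w))) := by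
  let adj := sheafificationAdjunction J (Type w)
  refine nonempty_localStateClassifier ((presheafToSheaf J (Type w)).obj (sectionRelPresheaf J))
    (fun X => ⟨toSectionRel J X ≫ adj.unit.app (sectionRelPresheaf J)⟩) ?_ ?_
  · intro X Y i _
    apply Sheaf.hom_ext
    change i.hom ≫ toSectionRel J Y ≫ _ = toSectionRel J X ≫ _
    rw [← Category.assoc]
    congr 1
    ext U : 2; refine ConcreteCategory.hom_ext _ _ fun x => ?_
    exact Subtype.ext (sectionRel_app i.hom (injective_of_mono i) x)
  · intro Z k hk
    have wd : ∀ {X Y : Sheaf J (Type w)} {U : Cᵒᵖ} (x : X.obj.obj U) (y : Y.obj.obj U),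
        sectionRel x = sectionRel y → (k X).hom.app U x = (k Y).hom.app U y := by
      intro X Y U x y h
      obtain ⟨H, z, a, b, ha, hb, rfl, rfl⟩ := exists_common_subsheaf x y h
      have e1 := hk _ _ a
      have e2 := hk _ _ b
      trans (k H).hom.app U z
      · rw [← e1]
        rfl
      · rw [← e2]
        rfl
    let d : sectionRelPresheaf J ⟶ Z.obj :=
      { app := fun U => ↾fun R => (k R.2.choose).hom.app U R.2.choose_spec.choose
        naturality := fun U V g => by
          refine ConcreteCategory.hom_ext _ _ fun R => ?_
          refine Eq.trans (wd _ (R.2.choose.obj.map g R.2.choose_spec.choose) ?_)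
            (NatTrans.naturality_apply _ _ _)
          rw [sectionRel_map, R.2.choose_spec.choose_spec]
          exact ((sectionRelPresheaf J).map g R).2.choose_spec.choose_spec }
    have hd : ∀ X, toSectionRel J X ≫ d = (k X).hom := by
      intro X
      ext U : 2; refine ConcreteCategory.hom_ext _ _ fun x => ?_
      exact wd _ _ (toSectionRel J X |>.app U x).2.choose_spec.choose_spec
    let ξ : ∀ X, X ⟶ (presheafToSheaf J (Type w)).obj (sectionRelPresheaf J) := fun X =>
      ⟨toSectionRel J X ≫ adj.unit.app (sectionRelPresheaf J)⟩
    have key : ∀ f : (presheafToSheaf J (Type w)).obj (sectionRelPresheaf J) ⟶ Z,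
        (∀ X, ξ X ≫ f = k X) ↔
          adj.homEquiv _ _ f = d := by
      intro f
      have e : ∀ X, (ξ X ≫ f).hom =
          toSectionRel J X ≫ adj.homEquiv _ _ f := by
        intro X
        rw [adj.homEquiv_unit]
        exact Category.assoc _ _ _
      constructor
      · intro h
        ext U : 2; refine ConcreteCategory.hom_ext _ _ fun R => ?_
        obtain ⟨_, X, x, rfl⟩ := R
        have h1 := (e X).symm.trans ((congrArg (fun t => t.hom) (h X)).trans (hd X).symm)
        exact ConcreteCategory.congr_hom (congr_app h1 U) x
      · intro h X
        apply Sheaf.hom_ext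
        rw [e, h, hd]
    refine ⟨(adj.homEquiv _ _).symm d, (key _).2 (Equiv.apply_symm_apply _ _), fun f hf => ?_⟩
    rw [Equiv.eq_symm_apply]
    exact (key f).1 hf

end Sheaves

theorem IsGrothendieckTopos.properties (E : Type u) [Category.{v} E] [IsGrothendieckTopos.{w} E] :
    IsElementaryTopos E ∧ LocallySmall.{w} E ∧ Nonempty (LocalStateClassifier E) := by
  obtain ⟨C, _, J, ⟨e⟩⟩ := IsGrothendieckTopos.exists_site.{w} (E := E)
  exact ⟨isElementaryTopos_of_equivalence e, locallySmall_of_faithful e.functor,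
    nonempty_localStateClassifier_of_equivalence e nonempty_localStateClassifier_sheaf.some⟩

end ToposQuotient

end

theorem mainTheorem2 :
    (∀ (E : Type u) [Category.{v} E] [IsElementaryTopos E] [IsBoolean E]
        (𝒮 : LocalStateClassifier E) (𝒞 : Subobject.Classifier E),
      (∃ (α : QuotientOf E ≃ InternalFilter 𝒮.semilattice)
          (β : InternalFilter 𝒮.semilattice ≃
            SemilatticeHom 𝒮.semilattice (omegaSemilattice 𝒞)),
        (∀ (q : ConnectedMorphismFrom E) (X : E),
          q.morphism.inverseImage.essImage X ↔ (α q.toQuotient).1.Factors (𝒮.ξ X)) ∧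
        (∀ F : InternalFilter 𝒮.semilattice,
          IsPullback F.1.arrow (𝒞.χ₀ _) (β F).hom 𝒞.truth)) ∧
      (∀ (F : Type u') [Category.{v'} F] [IsElementaryTopos F] (f : GeometricMorphism E F),
        f.IsConnected → ∃ q : ConnectedMorphismFrom E, f.Identified q.morphism) ∧
      (LocallySmall.{w} E → Small.{w} (QuotientOf E))) ∧
    (∀ (E : Type u) [Category.{v} E] [IsGrothendieckTopos.{w} E],
      IsElementaryTopos E ∧ LocallySmall.{w} E ∧ Nonempty (LocalStateClassifier E) ∧
      (IsBoolean E → Small.{w} (QuotientOf E))) := by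
  refine ⟨fun E _ _ _ 𝒮 𝒞 => ⟨?_, fun F _ _ f hf => exists_identified 𝒮 f hf,
    fun _ => small_quotientOf 𝒮⟩, fun E _ _ => ?_⟩
  · obtain ⟨α, hα⟩ := exists_quotientEquivFilter 𝒮
    refine ⟨α, filterEquivHom 𝒮.semilattice 𝒞, fun q X => ?_, fun F => 𝒞.isPullback F.1.arrow⟩
    rw [hα q]
    rfl
  · obtain ⟨h1, h2, ⟨𝒮⟩⟩ := IsGrothendieckTopos.properties.{w} E
    exact ⟨h1, h2, ⟨𝒮⟩, fun _ => small_quotientOf 𝒮⟩
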